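/- Let $(M,g)$ be a smooth, second countable Riemannian manifold without boundary and let $\mathcal{F}$ be a smooth foliation of $M$. Let $\mu_M$ be the Riemannian (Lebesgue) measure of $M$, and for a leaf $L\in\mathcal{F}$ let $\mu_L$ be the Riemannian (Lebesgue) measure of $L$ for the induced metric. A property is said to hold for almost every leaf if the union of the leaves for which it fails is a $\mu_M$-null set. Let $1<p<\infty$. Let $\mathrm{adm}_p(\mathcal{F})$ be the set of all functions $f\in L^p(M)$ with $f\ge 0$ almost everywhere and $\int_L f\,d\mu_L\ge 1$ for almost every leaf $L\in\mathcal{F}$ (the value $\infty$ is allowed), and let $$\mathrm{mod}_p(\mathcal{F})=\inf_{f\in\mathrm{adm}_p(\mathcal{F})}\|f\|_{L^p(M)}\qquad(=\infty\text{ if }\mathrm{adm}_p(\mathcal{F})=\emptyset)$$ be the $p$-modulus of $\mathcal{F}$. A function $f_0\in\mathrm{adm}_p(\mathcal{F})$ is called extremal for the $p$-modulus of $\mathcal{F}$ if $\|f_0\|_{L^p(M)}=\mathrm{mod}_p(\mathcal{F})$. If $f_0$ is extremal for the $p$-modulus of $\mathcal{F}$, then 1. $\int_L f_0\,d\mu_L=1$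 for almost every leaf $L\in\mathcal{F}$; 2. $f_0>0$ $\mu_M$-almost everywhere on $M$. -/

import Mathlib

open MeasureTheory Set Topology Bundle
open scoped Manifold ContDiff ENNReal

noncomputable section

/-- A smooth foliation of dimension `k` and codimension `q` on a smooth manifold `M` without
boundary of dimension `k + q`, given by an atlas of foliated charts. A foliated chart is a
diffeomorphism of an open subset of `M` onto `ℝᵏ × ℝ^q`; its plaques are the sets on which the
transverse (second) coordinate is constant. The chart domains cover `M`, and the transition maps
are locally of the form `(x, y) ↦ (h (x, y), γ y)`. -/
structure SmoothFoliation (k q : ℕ) (M : Type*) [TopologicalSpace M]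
    [ChartedSpace (EuclideanSpace ℝ (Fin (k + q))) M] where
  /-- The foliated charts. -/
  charts : Set (OpenPartialHomeomorph M (EuclideanSpace ℝ (Fin k) × EuclideanSpace ℝ (Fin q)))
  target_eq : ∀ e ∈ charts, e.target = univ
  contMDiffOn : ∀ e ∈ charts,
    ContMDiffOn (𝓡 (k + q)) 𝓘(ℝ, EuclideanSpace ℝ (Fin k) × EuclideanSpace ℝ (Fin q)) ∞
      e e.source
  contMDiffOn_symm : ∀ e ∈ charts,
    ContMDiffOn 𝓘(ℝ, EuclideanSpace ℝ (Fin k) × EuclideanSpace ℝ (Fin q)) (𝓡 (k + q)) ∞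
      e.symm e.target
  cover : ∀ x : M, ∃ e ∈ charts, x ∈ e.source
  compatible : ∀ e ∈ charts, ∀ e' ∈ charts, ∀ z ∈ e.source ∩ e'.source,
    ∃ W ∈ 𝓝 z, W ⊆ e.source ∩ e'.source ∧
      ∀ w ∈ W, ∀ w' ∈ W, (e w).2 = (e w').2 → (e' w).2 = (e' w').2

namespace SmoothFoliation

/-- Two points lie on a common plaque of a foliated chart. -/
def SamePlaque {k q : ℕ} {M : Type*} [TopologicalSpace M]
    [ChartedSpace (EuclideanSpace ℝ (Fin (k + q))) M] (F : SmoothFoliation k q M) (x y : M) :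
    Prop :=
  ∃ e ∈ F.charts, x ∈ e.source ∧ y ∈ e.source ∧ (e x).2 = (e y).2

/-- The leaf through `x`: the points that can be joined to `x` by a finite chain of plaques. -/
def leaf {k q : ℕ} {M : Type*} [TopologicalSpace M]
    [ChartedSpace (EuclideanSpace ℝ (Fin (k + q))) M] (F : SmoothFoliation k q M) (x : M) :
    Set M :=
  {y | Relation.EqvGen F.SamePlaque x y}

/-- The Riemannian (Lebesgue) measure `μ_M` of the ambient Riemannian manifold, of dimension
`k + q`: the Hausdorff measure of dimension `k + q` of the Riemannian distance, in the
normalization in which it is Lebesgue measure on Euclidean space. -/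
def volM {k q : ℕ} {M : Type*} [EMetricSpace M] [MeasurableSpace M] [BorelSpace M]
    [ChartedSpace (EuclideanSpace ℝ (Fin (k + q))) M] (_F : SmoothFoliation k q M) :
    Measure M :=
  μHE[k + q]

/-- The Riemannian (Lebesgue) measure `μ_L` of a leaf `L`, seen as a measure on `M` carried by `L`.
A leaf is an injectively immersed `k`-dimensional submanifold, a countable union of embedded
plaques; its Riemannian measure for the induced metric is the `k`-dimensional Hausdorff measure
(in the Euclidean normalization) on subsets of `L`. -/
def volLeaf {k q : ℕ} {M : Type*} [EMetricSpace M] [MeasurableSpace M] [BorelSpace M]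
    [ChartedSpace (EuclideanSpace ℝ (Fin (k + q))) M] (_F : SmoothFoliation k q M) (L : Set M) :
    Measure M :=
  (μHE[k] : Measure M).restrict L

/-- A property holds for almost every leaf: the union of the leaves on which it fails is a null
set of `M`. -/
def AlmostEveryLeaf {k q : ℕ} {M : Type*} [EMetricSpace M] [MeasurableSpace M] [BorelSpace M]
    [ChartedSpace (EuclideanSpace ℝ (Fin (k + q))) M] (F : SmoothFoliation k q M)
    (P : Set M → Prop) : Prop :=
  ∀ᵐ x ∂F.volM, P (F.leaf x)

/-- The integral `∫_L f dμ_L ∈ [0, ∞]` of a nonnegative function `f` over a leaf `L`. -/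
def leafIntegral {k q : ℕ} {M : Type*} [EMetricSpace M] [MeasurableSpace M] [BorelSpace M]
    [ChartedSpace (EuclideanSpace ℝ (Fin (k + q))) M] (F : SmoothFoliation k q M)
    (f : M → ℝ) (L : Set M) : ℝ≥0∞ :=
  ∫⁻ y, ENNReal.ofReal (f y) ∂F.volLeaf L

/-- `f ∈ adm_p(F)`: a nonnegative function in `Lᵖ(M)` whose integral over almost every leaf is at
least one. As usual for elements of `Lᵖ`, nonnegativity is meant almost everywhere. -/
structure IsAdmissible {k q : ℕ} {M : Type*} [EMetricSpace M] [MeasurableSpace M] [BorelSpace M]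
    [ChartedSpace (EuclideanSpace ℝ (Fin (k + q))) M] (F : SmoothFoliation k q M)
    (p : ℝ) (f : M → ℝ) : Prop where
  memLp : MemLp f (ENNReal.ofReal p) F.volM
  nonneg : ∀ᵐ x ∂F.volM, 0 ≤ f x
  one_le : F.AlmostEveryLeaf fun L => 1 ≤ F.leafIntegral f L

/-- The `p`-modulus of a foliation: the infimum of the `Lᵖ` norms of the admissible functions
(`∞` if there are none). -/
def modulus {k q : ℕ} {M : Type*} [EMetricSpace M] [MeasurableSpace M] [BorelSpace M]
    [ChartedSpace (EuclideanSpace ℝ (Fin (k + q))) M] (F : SmoothFoliation k q M)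
    (p : ℝ) : ℝ≥0∞ :=
  ⨅ (f : M → ℝ) (_ : F.IsAdmissible p f), eLpNorm f (ENNReal.ofReal p) F.volM

/-- `f₀` is extremal for the `p`-modulus: it is admissible and its norm is the modulus. -/
structure IsExtremal {k q : ℕ} {M : Type*} [EMetricSpace M] [MeasurableSpace M] [BorelSpace M]
    [ChartedSpace (EuclideanSpace ℝ (Fin (k + q))) M] (F : SmoothFoliation k q M)
    (p : ℝ) (f₀ : M → ℝ) : Prop where
  isAdmissible : F.IsAdmissible p f₀
  modulus_eq : F.modulus p = eLpNorm f₀ (ENNReal.ofReal p) F.volM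

end SmoothFoliation

end

/-! Both claims follow by comparing `f₀` with competitors that are modified on whole leaves.

For the first, let `J` be the leaf integral of `f₀`, constant on leaves and at least 1 almost
everywhere. Dividing `f₀` by `min (J, 2)` leaves it admissible and decreases it pointwise.
Minimality of the norm then forces `f₀ = 0` almost everywhere on the leaves with `J > 1`. Almost all
such leaves would have integral 0, which admissibility forbids
(`IsExtremal.ae_leafIntegral_eq_one`).

For the second, let `f₀` vanish on a compact set `A`, and let `S` be a union of leaves that meet `A`
in measure at least `1 / c`. Replacing `f₀` on `S` by `c` times the indicator of `A` gives an
admissible `h`. On `S` the functions `f₀` and `h` have disjoint supports, so testing minimality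
against `(1 - ε) f₀ + ε h` gives `∫_S f₀ ^ p ≤ (1 - ε) ^ p ∫_S f₀ ^ p + ε ^ p c ^ p μ(A)`. As `p >
1`, letting `ε → 0` yields `f₀ = 0` on `S` (`IsExtremal.ae_eq_zero_of_mem`), so `S` is null by
admissibility. Hence almost every leaf meets `A` in measure zero, and `A` is null by Fubini. Inner
regularity passes from compact sets to the zero set of `f₀`.

What carries these arguments is a link between `μ_M` and the leaf measures at the level of null sets
only: a null set is null on almost every leaf (`ae_euclideanHausdorffMeasure_inter_leaf_eq_zero`),
and conversely for Borel sets (`volM_eq_zero_of_ae_inter_leaf`). Foliated charts and their inverses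
are locally Lipschitz, so this reduces to Fubini in `ℝᵏ × ℝ^q`. Competitors must also be measurable.
The leaf relation is σ-compact (`isSigmaCompact_leafRel`), and Hausdorff measures of slices of
σ-compact sets are Borel in the base point, so leaf integrals are measurable up to null sets
(`exists_measurable_lintegral_volLeaf`). -/

section RiemannianLipschitz

/-! ### Local Lipschitz bounds for C¹ maps and the Riemannian distance -/

open Manifold Metric
open scoped NNReal

variable {E : Type*} [NormedAddCommGroup E] [NormedSpace ℝ E]
  {H : Type*} [TopologicalSpace H] {I : ModelWithCorners ℝ E H}

section

variable {M : Type*} [TopologicalSpace M] [ChartedSpace H M]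
  [RiemannianBundle (fun x : M => TangentSpace I x)]
  [IsManifold I 1 M] [IsContinuousRiemannianBundle E (fun x : M => TangentSpace I x)]

theorem eventually_enorm_mfderivWithin_symm_extChartAt_apply_le (x : M) :
    ∃ C > (0 : ℝ≥0), ∀ᶠ y in 𝓝[range I] (extChartAt I x x), ∀ v : E,
      ‖mfderivWithin 𝓘(ℝ, E) I (extChartAt I x).symm (range I) y v‖ₑ ≤ C * ‖v‖ₑ := by
  rcases eventually_enorm_mfderivWithin_symm_extChartAt_lt I x with ⟨C, C_pos, hC⟩
  refine ⟨C, C_pos, ?_⟩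
  filter_upwards [hC] with y hy v
  let f : E →L[ℝ] TangentSpace I ((extChartAt I x).symm y) :=
    mfderivWithin 𝓘(ℝ, E) I (extChartAt I x).symm (range I) y
  have hf : ‖f‖ₑ < C := hy
  exact (ContinuousLinearMap.le_opENorm f v).trans (mul_le_mul_left hf.le _)

theorem eventually_enorm_mfderiv_extChartAt_apply_le (x : M) :
    ∃ C > (0 : ℝ≥0), ∀ᶠ y in 𝓝 x, ∀ v : TangentSpace I y,
      @enorm E _ (mfderiv I 𝓘(ℝ, E) (extChartAt I x) y v) ≤ C * ‖v‖ₑ := by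
  rcases eventually_enorm_mfderiv_extChartAt_lt I x with ⟨C, C_pos, hC⟩
  refine ⟨C, C_pos, ?_⟩
  filter_upwards [hC] with y hy v
  let f : TangentSpace I y →L[ℝ] E := mfderiv I 𝓘(ℝ, E) (extChartAt I x) y
  have hf : ‖f‖ₑ < C := hy
  exact (ContinuousLinearMap.le_opENorm f v).trans (mul_le_mul_left hf.le _)

end

variable {M : Type*} [PseudoEMetricSpace M] [ChartedSpace H M]
  [RiemannianBundle (fun x : M => TangentSpace I x)]
  [IsManifold I 1 M] [IsContinuousRiemannianBundle E (fun x : M => TangentSpace I x)]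
  [IsRiemannianManifold I M]

/-- The segment between two points of a small ball in the chart is pushed to `M`. Its image has
length at most `C` times the Euclidean length, which bounds the Riemannian distance. -/
theorem exists_lipschitzOnWith_extChartAt_symm [I.Boundaryless] (x : M) :
    ∃ C : ℝ≥0, ∃ s ∈ 𝓝 (extChartAt I x x), LipschitzOnWith C (extChartAt I x).symm s := by
  rcases eventually_enorm_mfderivWithin_symm_extChartAt_apply_le (I := I) x with ⟨C, C_pos, hC⟩
  obtain ⟨r, r_pos, hr⟩ : ∃ r > 0,
      ball (extChartAt I x x) r ∩ range I ⊆ (extChartAt I x).target ∩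
        {y | ∀ v : E, ‖mfderivWithin 𝓘(ℝ, E) I (extChartAt I x).symm (range I) y v‖ₑ
          ≤ C * ‖v‖ₑ} :=
    mem_nhdsWithin_iff.1 (Filter.inter_mem (extChartAt_target_mem_nhdsWithin x) hC)
  refine ⟨C, ball (extChartAt I x x) r, ball_mem_nhds _ r_pos, fun a ha b hb => ?_⟩
  let η := ContinuousAffineMap.lineMap (R := ℝ) a b
  set γ := (extChartAt I x).symm ∘ η
  have hη : Icc 0 1 ⊆ ⇑η ⁻¹' ((extChartAt I x).target ∩
        {y | ∀ v : E, ‖mfderivWithin 𝓘(ℝ, E) I (extChartAt I x).symm (range I) y v‖ₑ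
          ≤ C * ‖v‖ₑ}) := by
    simp only [← image_subset_iff, ContinuousAffineMap.coe_lineMap_eq,
     ← segment_eq_image_lineMap, η]
    refine Subset.trans ?_ hr
    rw [I.range_eq_univ, inter_univ]
    exact (convex_ball _ _).segment_subset ha hb
  simp only [preimage_inter, subset_inter_iff] at hη
  have η_smooth : CMDiff[Icc 0 1] 1 η := by
    apply ContMDiff.contMDiffOn
    rw [contMDiff_iff_contDiff]
    exact ContinuousAffineMap.contDiff _
  have key : riemannianEDist I ((extChartAt I x).symm a) ((extChartAt I x).symm b)
      ≤ pathELength I γ 0 1 := by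
    apply riemannianEDist_le_pathELength _ _ _ zero_le_one
    · exact (contMDiffOn_extChartAt_symm x).comp η_smooth hη.1
    · simp [γ, η, ContinuousAffineMap.coe_lineMap_eq]
    · simp [γ, η, ContinuousAffineMap.coe_lineMap_eq]
  rw [IsRiemannianManifold.out (I := I)]
  apply key.trans
  rw [← lintegral_fderiv_lineMap_eq_edist, pathELength_eq_lintegral_mfderivWithin_Icc,
    ← lintegral_const_mul' _ _ ENNReal.coe_ne_top]
  apply setLIntegral_mono' measurableSet_Icc (fun t ht ↦ ?_)
  have h1 : mfderiv[Icc 0 1] γ t =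
      (mfderiv[range I] (extChartAt I x).symm (η t)) ∘L (mfderiv[Icc 0 1] η t) := by
    apply mfderivWithin_comp
    · exact mdifferentiableWithinAt_extChartAt_symm (hη.1 ht)
    · exact η_smooth.mdifferentiableOn one_ne_zero t ht
    · exact hη.1.trans (preimage_mono (extChartAt_target_subset_range x))
    · rw [uniqueMDiffWithinAt_iff_uniqueDiffWithinAt]
      exact uniqueDiffOn_Icc zero_lt_one t ht
  have h2 : mfderiv[Icc 0 1] γ t 1 =
      (mfderiv[range I] (extChartAt I x).symm (η t)) (mfderiv[Icc 0 1] η t 1) := congr($h1 1)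
  rw [h2]
  refine (hη.2 ht _).trans (le_of_eq ?_)
  simp only [mfderivWithin_eq_fderivWithin]
  rfl

/-- Almost minimizing paths in `M` are mapped to the chart, where the derivative bound controls the
displacement of the endpoints. -/
theorem exists_lipschitzOnWith_extChartAt (x : M) :
    ∃ C : ℝ≥0, ∃ s ∈ 𝓝 x, LipschitzOnWith C (extChartAt I x) s := by
  rcases eventually_enorm_mfderiv_extChartAt_apply_le (I := I) x with ⟨C, C_pos, hC⟩
  obtain ⟨ρ, ρ_pos, hρ⟩ := EMetric.mem_nhds_iff.1
    (Filter.inter_mem hC (extChartAt_source_mem_nhds (I := I) x))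
  -- The third makes paths stay in the good ball: one of length below `2ρ/3` starting within `ρ/3`
  -- of `x` cannot leave the ball of radius `ρ`.
  have hρ3 : 0 < ρ / 3 := ENNReal.div_pos ρ_pos.ne' (by simp)
  refine ⟨C, Metric.eball x (ρ / 3), Metric.eball_mem_nhds x hρ3, fun y hy z hz => ?_⟩
  have hyz : edist y z < ρ / 3 + ρ / 3 :=
    (edist_triangle_right y z x).trans_lt (ENNReal.add_lt_add hy hz)
  have hC0 : (C : ℝ≥0∞) ≠ 0 := by exact_mod_cast C_pos.ne'
  rw [mul_comm, ← ENNReal.div_le_iff hC0 ENNReal.coe_ne_top]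
  -- The infimum defining the distance need not be attained, so the bound is proved for every `r`
  -- above it.
  refine le_of_forall_gt_imp_ge_of_dense fun r hr => ?_
  rw [ENNReal.div_le_iff hC0 ENNReal.coe_ne_top, mul_comm]
  have hr' : edist y z < min r (ρ / 3 + ρ / 3) := lt_min hr hyz
  rw [IsRiemannianManifold.out (I := I)] at hr'
  obtain ⟨γ, hγ0, hγ1, γ_smooth, hγ, -⟩ :=
    exists_lt_locally_constant_of_riemannianEDist_lt hr' zero_lt_one
  have hmem : ∀ t ∈ Icc (0 : ℝ) 1, γ t ∈ Metric.eball x ρ := by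
    intro t ht
    have h1 : edist y (γ t) < ρ / 3 + ρ / 3 := by
      rw [IsRiemannianManifold.out (I := I)]
      calc riemannianEDist I y (γ t) ≤ pathELength I γ 0 t :=
            riemannianEDist_le_pathELength γ_smooth.contMDiffOn hγ0 rfl ht.1
        _ ≤ pathELength I γ 0 1 := pathELength_mono le_rfl ht.2
        _ < ρ / 3 + ρ / 3 := hγ.trans_le (min_le_right _ _)
    rw [Metric.mem_eball]
    calc edist (γ t) x ≤ edist (γ t) y + edist y x := edist_triangle _ _ _
      _ < (ρ / 3 + ρ / 3) + ρ / 3 := ENNReal.add_lt_add (by rwa [edist_comm]) hy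
      _ = ρ := ENNReal.add_thirds ρ
  let γ' := extChartAt I x ∘ γ
  have hsrc : ∀ t ∈ Icc (0 : ℝ) 1, γ t ∈ (chartAt H x).source := fun t ht => by
    have := (hρ (hmem t ht)).2
    rwa [extChartAt_source] at this
  have hC' : CMDiff[Icc 0 1] 1 γ' :=
    contMDiffOn_extChartAt.comp (I' := I) (t := (chartAt H x).source)
      γ_smooth.contMDiffOn hsrc
  have e0 : edist (extChartAt I x y) (extChartAt I x z) = ‖γ' 1 - γ' 0‖ₑ := by
    rw [edist_comm, edist_eq_enorm_sub]
    simp [γ', hγ0, hγ1]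
  rw [e0]
  calc
    ‖γ' 1 - γ' 0‖ₑ
    _ ≤ ∫⁻ t' in Icc 0 1, ‖derivWithin γ' (Icc 0 1) t'‖ₑ := by
      apply enorm_sub_le_lintegral_derivWithin_Icc_of_contDiffOn_Icc _ zero_le_one
      rwa [← contMDiffOn_iff_contDiffOn]
    _ ≤ ∫⁻ t' in Icc 0 1, C * ‖mfderiv[Icc 0 1] γ t' 1‖ₑ := by
      apply setLIntegral_mono' measurableSet_Icc (fun t' ht' ↦ ?_)
      have h1 : mfderiv[Icc 0 1] γ' t' =
          (mfderiv% (extChartAt I x) (γ t')) ∘L (mfderiv[Icc 0 1] γ t') := by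
        apply mfderiv_comp_mfderivWithin
        · exact mdifferentiableAt_extChartAt (hsrc t' ht')
        · exact (γ_smooth.mdifferentiable one_ne_zero).mdifferentiableOn _ ht'
        · rw [uniqueMDiffWithinAt_iff_uniqueDiffWithinAt]
          exact uniqueDiffOn_Icc zero_lt_one _ ht'
      have h2 : derivWithin γ' (Icc 0 1) t' =
          (mfderiv% (extChartAt I x) (γ t')) (mfderiv[Icc 0 1] γ t' 1) := by
        rw [← fderivWithin_derivWithin, ← mfderivWithin_eq_fderivWithin]
        exact congr($h1 1)
      rw [h2]
      exact (hρ (hmem t' ht')).1 _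
    _ = C * pathELength I γ 0 1 := by
      rw [lintegral_const_mul' _ _ ENNReal.coe_ne_top,
          pathELength_eq_lintegral_mfderivWithin_Icc]
    _ ≤ C * r := by
      gcongr
      exact hγ.le.trans (min_le_left _ _)

/-- A map of class `C¹` from a Riemannian manifold without boundary to a normed space is locally
Lipschitz. -/
theorem ContMDiffAt.exists_lipschitzOnWith_of_riemannian [I.Boundaryless]
    {F : Type*} [NormedAddCommGroup F] [NormedSpace ℝ F] {f : M → F} {x : M}
    (hf : ContMDiffAt I 𝓘(ℝ, F) 1 f x) :
    ∃ C : ℝ≥0, ∃ s ∈ 𝓝 x, LipschitzOnWith C f s := by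
  obtain ⟨C, s, hs, hCs⟩ := exists_lipschitzOnWith_extChartAt (I := I) x
  have h1 : ContDiffAt ℝ 1 (f ∘ (extChartAt I x).symm) (extChartAt I x x) := by
    have := (contMDiffAt_iff.1 hf).2
    rw [I.range_eq_univ, contDiffWithinAt_univ] at this
    exact this
  obtain ⟨K, t, ht, hKt⟩ := h1.exists_lipschitzOnWith
  have hpre := (continuousAt_extChartAt (I := I) x).preimage_mem_nhds ht
  refine ⟨K * C, s ∩ extChartAt I x ⁻¹' t ∩ (extChartAt I x).source,
    Filter.inter_mem (Filter.inter_mem hs hpre) (extChartAt_source_mem_nhds x), ?_⟩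
  have h2 : LipschitzOnWith (K * C) ((f ∘ (extChartAt I x).symm) ∘ extChartAt I x)
      (s ∩ extChartAt I x ⁻¹' t ∩ (extChartAt I x).source) :=
    hKt.comp (hCs.mono fun y hy => hy.1.1) fun y hy => hy.1.2
  intro y hy z hz
  have := h2 hy hz
  simpa only [Function.comp_apply, (extChartAt I x).left_inv hy.2,
    (extChartAt I x).left_inv hz.2] using this

/-- A map of class `C¹` from a normed space to a Riemannian manifold without boundary is locally
Lipschitz. -/
theorem ContMDiffAt.exists_lipschitzOnWith_to_riemannian [I.Boundaryless]
    {F : Type*} [NormedAddCommGroup F] [NormedSpace ℝ F] {g : F → M} {a : F}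
    (hg : ContMDiffAt 𝓘(ℝ, F) I 1 g a) :
    ∃ C : ℝ≥0, ∃ s ∈ 𝓝 a, LipschitzOnWith C g s := by
  obtain ⟨C, s, hs, hCs⟩ := exists_lipschitzOnWith_extChartAt_symm (I := I) (g a)
  have h1 : ContDiffAt ℝ 1 (extChartAt I (g a) ∘ g) a := by
    have := (contMDiffAt_iff.1 hg).2
    rw [modelWithCornersSelf_coe, range_id, contDiffWithinAt_univ] at this
    exact this
  obtain ⟨K, t, ht, hKt⟩ := h1.exists_lipschitzOnWith
  have hsrc := hg.continuousAt.preimage_mem_nhds (extChartAt_source_mem_nhds (I := I) (g a))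
  have hpre := h1.continuousAt.preimage_mem_nhds hs
  refine ⟨C * K, t ∩ (extChartAt I (g a) ∘ g) ⁻¹' s ∩ g ⁻¹' (extChartAt I (g a)).source,
    Filter.inter_mem (Filter.inter_mem ht hpre) hsrc, ?_⟩
  have h2 : LipschitzOnWith (C * K) ((extChartAt I (g a)).symm ∘ (extChartAt I (g a) ∘ g))
      (t ∩ (extChartAt I (g a) ∘ g) ⁻¹' s ∩ g ⁻¹' (extChartAt I (g a)).source) :=
    hCs.comp (hKt.mono fun y hy => hy.1.1) fun y hy => hy.1.2
  intro y hy z hz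
  have := h2 hy hz
  have e (y : F) (hy : g y ∈ (extChartAt I (g a)).source) :
      (extChartAt I (g a)).symm (extChartAt I (g a) (g y)) = g y := (extChartAt I (g a)).left_inv hy
  simpa only [Function.comp_apply, e y hy.2, e z hz.2] using this

end RiemannianLipschitz

/-! ### Measurability of the Hausdorff measure of slices -/

section HausdorffSlices

open scoped NNReal
open Filter Metric

/-- The size-`r` approximation of the `d`-dimensional Hausdorff measure, computed with countable
covers by open sets. -/
noncomputable def openCoverContent {Y : Type*} [EMetricSpace Y] (d : ℝ) (r : ℝ≥0∞) (s : Set Y) :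
    ℝ≥0∞ :=
  ⨅ (t : ℕ → Set Y) (_ : s ⊆ ⋃ n, t n) (_ : ∀ n, IsOpen (t n) ∧ ediam (t n) ≤ r),
    ∑' n, ⨆ _ : (t n).Nonempty, ediam (t n) ^ d

theorem exists_isOpen_superset_ediam_rpow_le {Y : Type*} [EMetricSpace Y] {d : ℝ} (hd : 0 ≤ d)
    {r r' : ℝ≥0∞} (hr : r < r') {s : Set Y} (hs : ediam s ≤ r) {ε : ℝ≥0∞} (hε : ε ≠ 0) :
    ∃ u, s ⊆ u ∧ IsOpen u ∧ ediam u ≤ r' ∧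
      (⨆ _ : u.Nonempty, ediam u ^ d) ≤ (⨆ _ : s.Nonempty, ediam s ^ d) + ε := by
  rcases s.eq_empty_or_nonempty with rfl | hne
  · exact ⟨∅, Subset.rfl, isOpen_empty, by simp, by simp⟩
  have hfin : ediam s ≠ ⊤ := (hs.trans_lt (hr.trans_le le_top)).ne
  have hlim : Tendsto (fun δ : ℝ≥0 => ediam s + 2 * (δ : ℝ≥0∞)) (𝓝 0) (𝓝 (ediam s)) := by
    have h : Continuous fun δ : ℝ≥0 => ediam s + 2 * (δ : ℝ≥0∞) := by
      refine continuous_const.add ?_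
      exact (ENNReal.continuous_const_mul (by simp)).comp ENNReal.continuous_coe
    simpa using h.tendsto 0
  have h1 : ∀ᶠ δ : ℝ≥0 in 𝓝 0, ediam s + 2 * (δ : ℝ≥0∞) < r' :=
    hlim.eventually_lt_const (hs.trans_lt hr)
  have h2 : ∀ᶠ δ : ℝ≥0 in 𝓝 0, (ediam s + 2 * (δ : ℝ≥0∞)) ^ d < ediam s ^ d + ε := by
    refine ((ENNReal.continuous_rpow_const.tendsto _).comp hlim).eventually_lt_const ?_
    exact ENNReal.lt_add_right (ENNReal.rpow_ne_top_of_nonneg hd hfin) hε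
  have h3 : ∀ᶠ δ : ℝ≥0 in 𝓝[>] 0, 0 < δ := self_mem_nhdsWithin
  obtain ⟨δ, ⟨hδ1, hδ2⟩, hδ⟩ :=
    (((h1.and h2).filter_mono nhdsWithin_le_nhds).and h3).exists
  refine ⟨thickening δ s, self_subset_thickening (by exact_mod_cast hδ) s, isOpen_thickening,
    (ediam_thickening_le δ).trans hδ1.le, iSup_le fun _ => ?_⟩
  calc ediam (thickening δ s) ^ d ≤ (ediam s + 2 * (δ : ℝ≥0∞)) ^ d :=
        ENNReal.rpow_le_rpow (ediam_thickening_le δ) hd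
    _ ≤ ediam s ^ d + ε := hδ2.le
    _ ≤ _ := by gcongr; exact le_iSup (fun _ : s.Nonempty => ediam s ^ d) hne

/-- Thickening each covering set slightly makes it open at an arbitrarily small total cost. With
open covers, the condition that a cover contains the slice of a compact set is open in the base
point. -/
theorem hausdorffMeasure_eq_iSup_openCoverContent {Y : Type*} [EMetricSpace Y]
    [MeasurableSpace Y] [BorelSpace Y] {d : ℝ} (hd : 0 ≤ d) (s : Set Y) :
    μH[d] s = ⨆ n : ℕ, openCoverContent d ((n : ℝ≥0∞) + 1)⁻¹ s := by
  rw [Measure.hausdorffMeasure_apply]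
  apply le_antisymm
  · refine iSup₂_le fun r hr => ?_
    obtain ⟨n, hn⟩ := ENNReal.exists_inv_nat_lt hr.ne'
    refine le_trans ?_ (le_iSup _ n)
    refine le_iInf₂ fun t ht => le_iInf fun h => ?_
    refine iInf₂_le_of_le t ht (iInf_le_of_le (fun i => (h i).2.trans ?_) le_rfl)
    refine le_trans ?_ hn.le
    exact ENNReal.inv_le_inv.2 le_self_add
  · refine iSup_le fun n => ?_
    have hpos : 0 < ((n : ℝ≥0∞) + 1)⁻¹ := by simp
    have hfin : ((n : ℝ≥0∞) + 1)⁻¹ ≠ ⊤ := by simp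
    -- Covers at half the scale leave room for thickening.
    refine le_trans ?_ (le_iSup₂ (((n : ℝ≥0∞) + 1)⁻¹ / 2) (ENNReal.half_pos hpos.ne'))
    refine le_iInf₂ fun t ht => le_iInf fun h => ?_
    refine ENNReal.le_of_forall_pos_le_add fun ε hε _ => ?_
    obtain ⟨ε', hε', hsum⟩ := ENNReal.exists_pos_sum_of_countable
      (ε := (ε : ℝ≥0∞)) (by exact_mod_cast hε.ne') ℕ
    choose u hu huo hud hle using fun i => exists_isOpen_superset_ediam_rpow_le hd
      (ENNReal.half_lt_self hpos.ne' hfin) (h i) (ε := (ε' i : ℝ≥0∞))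
      (by exact_mod_cast (hε' i).ne')
    refine iInf₂_le_of_le u (ht.trans (iUnion_mono hu))
      (iInf_le_of_le (fun i => ⟨huo i, hud i⟩) ?_)
    calc _ ≤ ∑' i, ((⨆ _ : (t i).Nonempty, ediam (t i) ^ d) + ε' i) := ENNReal.tsum_le_tsum hle
      _ = (∑' i, ⨆ _ : (t i).Nonempty, ediam (t i) ^ d) + ∑' i, (ε' i : ℝ≥0∞) :=
        ENNReal.tsum_add
      _ ≤ _ := by gcongr

/-- The complement is the projection of the compact set of points of `K` lying over `Vᶜ`, hence
closed. -/
theorem IsCompact.isOpen_setOf_slice_subset {X Z : Type*} [TopologicalSpace X] [T2Space X]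
    [TopologicalSpace Z] {K : Set (X × Z)}
    (hK : IsCompact K) {V : Set Z} (hV : IsOpen V) : IsOpen {x | {y | (x, y) ∈ K} ⊆ V} := by
  have h : {x | {y | (x, y) ∈ K} ⊆ V} = (Prod.fst '' (K ∩ Prod.snd ⁻¹' Vᶜ))ᶜ := by
    ext x
    simp only [mem_ofPred_eq, subset_def, mem_compl_iff, mem_image, mem_inter_iff, mem_preimage,
      Prod.exists, exists_and_right, exists_eq_right, not_exists, not_and, not_not]
  rw [h]
  exact ((hK.inter_right (hV.isClosed_compl.preimage continuous_snd)).image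
    continuous_fst).isClosed.isOpen_compl

theorem IsSigmaCompact.inter_isClosed {Z : Type*} [TopologicalSpace Z] {S T : Set Z}
    (hS : IsSigmaCompact S) (hT : IsClosed T) : IsSigmaCompact (S ∩ T) := by
  obtain ⟨K, hK, rfl⟩ := hS
  exact ⟨fun n => K n ∩ T, fun n => (hK n).inter_right hT, (iUnion_inter _ _).symm⟩

theorem IsSigmaCompact.slice {X Z : Type*} [TopologicalSpace X] [T1Space X] [TopologicalSpace Z]
    {S : Set (X × Z)} (hS : IsSigmaCompact S) (x : X) : IsSigmaCompact {y | (x, y) ∈ S} := by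
  have h : {y | (x, y) ∈ S} = Prod.snd '' (S ∩ Prod.fst ⁻¹' {x}) := by
    ext y; simp
  rw [h]
  exact (hS.inter_isClosed (isClosed_singleton.preimage continuous_fst)).image continuous_snd

theorem IsSigmaCompact.exists_monotone_isCompact {Z : Type*} [TopologicalSpace Z] {S : Set Z}
    (hS : IsSigmaCompact S) : ∃ K : ℕ → Set Z, Monotone K ∧ (∀ n, IsCompact (K n)) ∧
      ⋃ n, K n = S := by
  obtain ⟨K, hK, rfl⟩ := hS
  refine ⟨accumulate K, monotone_accumulate, fun n => ?_, iUnion_accumulate⟩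
  rw [accumulate_def]
  exact (finite_le_nat n).isCompact_biUnion fun i _ => hK i

variable {X Y : Type*} [TopologicalSpace X] [T2Space X] [MeasurableSpace X]
  [OpensMeasurableSpace X] [EMetricSpace Y] [MeasurableSpace Y] [BorelSpace Y]

/-- The Hausdorff measure of the slices of a compact set is a Borel function of the base point. -/
theorem IsCompact.measurable_hausdorffMeasure_slice {K : Set (X × Y)} (hK : IsCompact K) {d : ℝ}
    (hd : 0 ≤ d) : Measurable fun x => μH[d] {y | (x, y) ∈ K} := by
  simp_rw [hausdorffMeasure_eq_iSup_openCoverContent hd]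
  refine Measurable.iSup fun n => measurable_of_Iio fun c => IsOpen.measurableSet ?_
  -- The union over covers is uncountable, which is harmless because each member is open.
  have h : (fun x => openCoverContent d ((n : ℝ≥0∞) + 1)⁻¹ {y | (x, y) ∈ K}) ⁻¹' Iio c =
      ⋃ (t : ℕ → Set Y) (_ : ∀ i, IsOpen (t i) ∧ ediam (t i) ≤ ((n : ℝ≥0∞) + 1)⁻¹)
        (_ : ∑' i, (⨆ _ : (t i).Nonempty, ediam (t i) ^ d) < c),
        {x | {y | (x, y) ∈ K} ⊆ ⋃ i, t i} := by
    ext x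
    simp only [openCoverContent, mem_preimage, mem_Iio, iInf_lt_iff, mem_iUnion, mem_ofPred_eq,
      exists_prop]
    constructor
    · rintro ⟨t, h1, h2, h3⟩; exact ⟨t, h2, h3, h1⟩
    · rintro ⟨t, h2, h3, h1⟩; exact ⟨t, h1, h2, h3⟩
  rw [h]
  refine isOpen_iUnion fun t => isOpen_iUnion fun ht => isOpen_iUnion fun _ => ?_
  exact hK.isOpen_setOf_slice_subset (isOpen_iUnion fun i => (ht i).1)

theorem IsSigmaCompact.measurable_hausdorffMeasure_slice {S : Set (X × Y)} (hS : IsSigmaCompact S)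
    {d : ℝ} (hd : 0 ≤ d) : Measurable fun x => μH[d] {y | (x, y) ∈ S} := by
  obtain ⟨K, hmono, hK, rfl⟩ := hS.exists_monotone_isCompact
  have h : ∀ x, μH[d] {y | (x, y) ∈ ⋃ n, K n} = ⨆ n, μH[d] {y | (x, y) ∈ K n} := fun x => by
    have h1 : Monotone fun n => {y | (x, y) ∈ K n} := fun i j hij y hy => hmono hij hy
    rw [← h1.measure_iUnion]
    congr 1
    ext y
    simp
  simp_rw [h]
  exact Measurable.iSup fun n => (hK n).measurable_hausdorffMeasure_slice hd

theorem IsSigmaCompact.measurable_euclideanHausdorffMeasure_slice {S : Set (X × Y)}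
    (hS : IsSigmaCompact S) (d : ℕ) : Measurable fun x => μHE[d] {y | (x, y) ∈ S} := by
  simp_rw [Measure.euclideanHausdorffMeasure_def, Measure.smul_apply]
  exact (hS.measurable_hausdorffMeasure_slice d.cast_nonneg).const_smul _

end HausdorffSlices

/-! ### Lipschitz maps and Hausdorff null sets -/

section LipschitzNull

open scoped NNReal

theorem LipschitzOnWith.euclideanHausdorffMeasure_image_le {X Y : Type*} [EMetricSpace X]
    [MeasurableSpace X] [BorelSpace X] [EMetricSpace Y] [MeasurableSpace Y] [BorelSpace Y]
    {f : X → Y} {s : Set X} {K : ℝ≥0} (h : LipschitzOnWith K f s) (d : ℕ) :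
    μHE[d] (f '' s) ≤ (K : ℝ≥0∞) ^ d * μHE[d] s := by
  rw [Measure.euclideanHausdorffMeasure_def, Measure.euclideanHausdorffMeasure_def,
    Measure.smul_apply, Measure.smul_apply, ENNReal.smul_def, ENNReal.smul_def, smul_eq_mul,
    smul_eq_mul, mul_left_comm]
  gcongr
  simpa using h.hausdorffMeasure_image_le d.cast_nonneg

/-- Locally Lipschitz maps send Hausdorff null sets to Hausdorff null sets. -/
theorem euclideanHausdorffMeasure_image_eq_zero {X Y : Type*} [EMetricSpace X]
    [SecondCountableTopology X] [MeasurableSpace X] [BorelSpace X] [EMetricSpace Y]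
    [MeasurableSpace Y] [BorelSpace Y] {f : X → Y} {s : Set X} {d : ℕ}
    (hf : ∀ x ∈ s, ∃ C : ℝ≥0, ∃ t ∈ 𝓝 x, LipschitzOnWith C f t) (hs : μHE[d] s = 0) :
    μHE[d] (f '' s) = 0 := by
  choose! C t ht hC using hf
  obtain ⟨c, hcs, hc, hcov⟩ := TopologicalSpace.countable_cover_nhdsWithin
    (fun x hx => mem_nhdsWithin_of_mem_nhds (ht x hx))
  have hsub : f '' s ⊆ ⋃ x ∈ c, f '' (s ∩ t x) := by
    rintro _ ⟨y, hy, rfl⟩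
    obtain ⟨x, hx, hyx⟩ := mem_iUnion₂.1 (hcov hy)
    exact mem_iUnion₂.2 ⟨x, hx, mem_image_of_mem f ⟨hy, hyx⟩⟩
  refine measure_mono_null hsub ((measure_biUnion_null_iff hc).2 fun x hx => ?_)
  have h := ((hC x (hcs hx)).mono inter_subset_right).euclideanHausdorffMeasure_image_le
    (s := s ∩ t x) d
  rwa [measure_mono_null inter_subset_left hs, mul_zero, nonpos_iff_eq_zero] at h

/-- The product carries the sup metric, so equality of the two measures is not claimed. Both are
Haar measures, and that determines the null sets. -/
theorem euclideanHausdorffMeasure_prod_eq_zero_iff {k q : ℕ}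
    {s : Set (EuclideanSpace ℝ (Fin k) × EuclideanSpace ℝ (Fin q))} :
    μHE[k + q] s = 0 ↔ volume s = 0 := by
  have h : (μHE[k + q] : Measure (EuclideanSpace ℝ (Fin k) × EuclideanSpace ℝ (Fin q)))
      |>.IsAddHaarMeasure := by
    have := isAddHaarMeasure_euclideanHausdorffMeasure
      (E := EuclideanSpace ℝ (Fin k) × EuclideanSpace ℝ (Fin q))
    simpa using this
  have h' : (volume : Measure (EuclideanSpace ℝ (Fin k) × EuclideanSpace ℝ (Fin q)))
      |>.IsAddHaarMeasure := Measure.prod.instIsAddHaarMeasure _ _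
  exact ⟨fun hs => Measure.absolutelyContinuous_isAddHaarMeasure volume μHE[k + q] hs,
    fun hs => Measure.absolutelyContinuous_isAddHaarMeasure μHE[k + q] volume hs⟩

end LipschitzNull

/-! ### Plaque chains, σ-compactness of the leaf relation, leaves as countable unions of plaques -/

theorem IsSigmaCompact.setOf_comp {X Y Z : Type*} [TopologicalSpace X] [TopologicalSpace Y]
    [T2Space Y] [TopologicalSpace Z] {A : Set (X × Y)} {B : Set (Y × Z)} (hA : IsSigmaCompact A)
    (hB : IsSigmaCompact B) :
    IsSigmaCompact {p : X × Z | ∃ y, (p.1, y) ∈ A ∧ (y, p.2) ∈ B} := by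
  obtain ⟨K, hK, rfl⟩ := hA
  obtain ⟨L, hL, rfl⟩ := hB
  have h : {p : X × Z | ∃ y, (p.1, y) ∈ ⋃ n, K n ∧ (y, p.2) ∈ ⋃ n, L n} =
      ⋃ i : ℕ × ℕ, (fun w : (X × Y) × (Y × Z) => (w.1.1, w.2.2)) ''
        ((K i.1 ×ˢ L i.2) ∩ {w | w.1.2 = w.2.1}) := by
    ext ⟨x, z⟩
    simp only [mem_ofPred_eq, mem_iUnion, mem_image, mem_inter_iff, mem_prod, Prod.exists,
      Prod.mk.injEq]
    constructor
    · rintro ⟨y, ⟨i, hi⟩, ⟨j, hj⟩⟩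
      exact ⟨i, j, x, y, y, z, ⟨⟨hi, hj⟩, rfl⟩, rfl, rfl⟩
    · rintro ⟨i, j, x, y, y', z, ⟨⟨hi, hj⟩, rfl⟩, rfl, rfl⟩
      exact ⟨y, ⟨i, hi⟩, ⟨j, hj⟩⟩
  rw [h]
  refine isSigmaCompact_iUnion_of_isCompact _ fun i => IsCompact.image ?_ (by fun_prop)
  exact ((hK _).prod (hL _)).inter_right (isClosed_eq (by fun_prop) (by fun_prop))

namespace SmoothFoliation

section PlaqueRelation

variable {k q : ℕ} {M : Type*} [TopologicalSpace M]
  {c : Set (OpenPartialHomeomorph M (EuclideanSpace ℝ (Fin k) × EuclideanSpace ℝ (Fin q)))}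

/-- Two points lie on a common plaque of the chart `e`. -/
def PlaqueRel
    (e : OpenPartialHomeomorph M (EuclideanSpace ℝ (Fin k) × EuclideanSpace ℝ (Fin q)))
    (x y : M) : Prop :=
  x ∈ e.source ∧ y ∈ e.source ∧ (e x).2 = (e y).2

/-- Two points lie on a common plaque of one of the charts of `c`. -/
def PlaqueRelIn
    (c : Set (OpenPartialHomeomorph M (EuclideanSpace ℝ (Fin k) × EuclideanSpace ℝ (Fin q))))
    (x y : M) : Prop :=
  ∃ e ∈ c, PlaqueRel e x y

theorem PlaqueRel.symm
    {e : OpenPartialHomeomorph M (EuclideanSpace ℝ (Fin k) × EuclideanSpace ℝ (Fin q))}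
    {x y : M} (h : PlaqueRel e x y) : PlaqueRel e y x :=
  ⟨h.2.1, h.1, h.2.2.symm⟩

theorem PlaqueRel.trans
    {e : OpenPartialHomeomorph M (EuclideanSpace ℝ (Fin k) × EuclideanSpace ℝ (Fin q))}
    {x y z : M} (h : PlaqueRel e x y) (h' : PlaqueRel e y z) : PlaqueRel e x z :=
  ⟨h.1, h'.2.1, h.2.2.trans h'.2.2⟩

theorem PlaqueRelIn.symm
    {x y : M} (h : PlaqueRelIn c x y) : PlaqueRelIn c y x :=
  let ⟨e, he, h⟩ := h
  ⟨e, he, h.symm⟩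

/-- Since the chart is onto, pairs on a common plaque are the continuous image of `(ℝᵏ × ℝᵏ) × ℝ^q`.
-/
theorem isSigmaCompact_plaqueRel
    {e : OpenPartialHomeomorph M (EuclideanSpace ℝ (Fin k) × EuclideanSpace ℝ (Fin q))}
    (he : e.target = univ) : IsSigmaCompact {p : M × M | PlaqueRel e p.1 p.2} := by
  have hcont : Continuous e.symm := by
    rw [← continuousOn_univ, ← he]; exact e.continuousOn_symm
  have h : {p : M × M | PlaqueRel e p.1 p.2} =
      range fun w : (EuclideanSpace ℝ (Fin k) × EuclideanSpace ℝ (Fin k)) ×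
        EuclideanSpace ℝ (Fin q) => (e.symm (w.1.1, w.2), e.symm (w.1.2, w.2)) := by
    have htar : ∀ v, v ∈ e.target := fun v => he ▸ mem_univ v
    ext ⟨x, y⟩
    constructor
    · rintro ⟨hx, hy, hxy⟩
      refine ⟨(((e x).1, (e y).1), (e x).2), ?_⟩
      have hy' : ((e y).1, (e x).2) = e y := by rw [hxy]
      simp only [Prod.mk.eta, hy']
      rw [e.left_inv hx, e.left_inv hy]
    · rintro ⟨w, hw⟩
      obtain ⟨rfl, rfl⟩ := Prod.mk.inj hw
      refine ⟨e.map_target (htar _), e.map_target (htar _), ?_⟩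
      simp only
      rw [e.right_inv (htar _), e.right_inv (htar _)]
  rw [h]
  exact isSigmaCompact_range (by fun_prop)

theorem _root_.Relation.ReflTransGen.plaqueRelIn_symm {x y : M}
    (h : Relation.ReflTransGen (PlaqueRelIn c) x y) : Relation.ReflTransGen (PlaqueRelIn c) y x := by
  have : Std.Symm (PlaqueRelIn c) := ⟨fun _ _ h => h.symm⟩
  exact Std.Symm.symm _ _ h

/-- The pairs of points joined by a chain of `n` plaques of charts in `c`. -/
def plaqueChain
    (c : Set (OpenPartialHomeomorph M (EuclideanSpace ℝ (Fin k) × EuclideanSpace ℝ (Fin q)))) :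
    ℕ → Set (M × M)
  | 0 => {p | p.1 = p.2}
  | n + 1 => {p | ∃ y, (p.1, y) ∈ plaqueChain c n ∧ (y, p.2) ∈ {r : M × M | PlaqueRelIn c r.1 r.2}}

theorem reflTransGen_iff_exists_plaqueChain {x y : M} :
    Relation.ReflTransGen (PlaqueRelIn c) x y ↔ ∃ n, (x, y) ∈ plaqueChain c n := by
  constructor
  · intro h
    induction h with
    | refl => exact ⟨0, rfl⟩
    | tail _ h ih =>
      obtain ⟨n, hn⟩ := ih
      exact ⟨n + 1, _, hn, h⟩
  · rintro ⟨n, hn⟩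
    induction n generalizing y with
    | zero => obtain rfl : x = y := hn; exact Relation.ReflTransGen.refl
    | succ n ih => obtain ⟨z, hz, hzy⟩ := hn; exact (ih hz).tail hzy

end PlaqueRelation

variable {k q : ℕ} {M : Type*} [TopologicalSpace M]
  [ChartedSpace (EuclideanSpace ℝ (Fin (k + q))) M]
  {c : Set (OpenPartialHomeomorph M (EuclideanSpace ℝ (Fin k) × EuclideanSpace ℝ (Fin q)))}

variable (F : SmoothFoliation k q M)

theorem mem_leaf_self (x : M) : x ∈ F.leaf x := Relation.EqvGen.refl x

theorem leaf_eq_of_mem {x y : M} (h : y ∈ F.leaf x) : F.leaf y = F.leaf x := by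
  ext z
  exact ⟨fun hz => Relation.EqvGen.trans _ _ _ h hz,
    fun hz => Relation.EqvGen.trans _ _ _ (Relation.EqvGen.symm _ _ h) hz⟩

theorem exists_countable_charts [SecondCountableTopology M] :
    ∃ c ⊆ F.charts, c.Countable ∧ ∀ x, ∃ e ∈ c, x ∈ e.source := by
  choose e he hx using F.cover
  obtain ⟨s, hs, hcov⟩ := TopologicalSpace.countable_cover_nhds
    fun x => (e x).open_source.mem_nhds (hx x)
  refine ⟨e '' s, ?_, hs.image e, fun x => ?_⟩
  · rintro _ ⟨x, _, rfl⟩; exact he x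
  · have hxs : x ∈ ⋃ y ∈ s, (e y).source := hcov ▸ mem_univ x
    obtain ⟨y, hy, hxy⟩ := mem_iUnion₂.1 hxs
    exact ⟨e y, mem_image_of_mem e hy, hxy⟩

variable {F}

/-- A plaque is a continuous image of the connected space `ℝᵏ`, and by compatibility nearby points
of it share a plaque of a chart in `c`. Hence leaves may be computed with any subatlas that covers,
in particular a countable one. -/
theorem PlaqueRel.reflTransGen (hc : c ⊆ F.charts) (hcov : ∀ x, ∃ e ∈ c, x ∈ e.source)
    {e : OpenPartialHomeomorph M (EuclideanSpace ℝ (Fin k) × EuclideanSpace ℝ (Fin q))}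
    (he : e ∈ F.charts) {x y : M} (h : PlaqueRel e x y) :
    Relation.ReflTransGen (PlaqueRelIn c) x y := by
  have htar : ∀ v, v ∈ e.target := fun v => F.target_eq e he ▸ mem_univ v
  have hcont : Continuous e.symm := by
    rw [← continuousOn_univ, ← F.target_eq e he]; exact e.continuousOn_symm
  let g : EuclideanSpace ℝ (Fin k) → M := fun s => e.symm (s, (e x).2)
  have hg : Continuous g := hcont.comp (by fun_prop)
  have hge : ∀ s, (e (g s)).2 = (e x).2 := fun s => by rw [e.right_inv (htar _)]
  have key : ∀ s s', Relation.ReflTransGen (PlaqueRelIn c) (g s) (g s') := by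
    have htrans : IsTrans (EuclideanSpace ℝ (Fin k))
      fun s s' => Relation.ReflTransGen (PlaqueRelIn c) (g s) (g s') :=
      ⟨fun _ _ _ h1 h2 => Relation.ReflTransGen.trans h1 h2⟩
    have : Std.Symm fun s s' : EuclideanSpace ℝ (Fin k) =>
      Relation.ReflTransGen (PlaqueRelIn c) (g s) (g s') := ⟨fun _ _ h => h.plaqueRelIn_symm⟩
    refine PreconnectedSpace.induction₂
      (fun s s' => Relation.ReflTransGen (PlaqueRelIn c) (g s) (g s')) (fun s => ?_) htrans
    obtain ⟨e', he', hz⟩ := hcov (g s)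
    obtain ⟨W, hW, hWsub, hWc⟩ := F.compatible e he e' (hc he') (g s) ⟨e.map_target (htar _), hz⟩
    filter_upwards [hg.continuousAt.preimage_mem_nhds hW] with s' hs'
    refine Relation.ReflTransGen.single ⟨e', he', hz, (hWsub hs').2, ?_⟩
    exact hWc _ (mem_of_mem_nhds hW) _ hs' ((hge s).trans (hge s').symm)
  have hx : g (e x).1 = x := e.left_inv h.1
  have hy : g (e y).1 = y := by
    change e.symm ((e y).1, (e x).2) = y
    rw [h.2.2]
    exact e.left_inv h.2.1
  simpa only [hx, hy] using key (e x).1 (e y).1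

theorem mem_leaf_iff_reflTransGen (hc : c ⊆ F.charts) (hcov : ∀ x, ∃ e ∈ c, x ∈ e.source)
    {x y : M} : y ∈ F.leaf x ↔ Relation.ReflTransGen (PlaqueRelIn c) x y := by
  constructor
  · intro h
    change Relation.EqvGen F.SamePlaque x y at h
    induction h with
    | rel x y h =>
      obtain ⟨e, he, h⟩ := h
      exact PlaqueRel.reflTransGen hc hcov he h
    | refl x => exact Relation.ReflTransGen.refl
    | symm x y _ ih => exact ih.plaqueRelIn_symm
    | trans x y z _ _ ih1 ih2 => exact ih1.trans ih2
  · intro h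
    induction h with
    | refl => exact F.mem_leaf_self x
    | tail _ h ih =>
      obtain ⟨e, he, h⟩ := h
      exact Relation.EqvGen.trans _ _ _ ih (Relation.EqvGen.rel _ _ ⟨e, hc he, h⟩)

theorem mem_leaf_of_plaqueRelIn (hc : c ⊆ F.charts) {x y : M} (h : PlaqueRelIn c x y) :
    y ∈ F.leaf x :=
  let ⟨e, he, h⟩ := h
  Relation.EqvGen.rel _ _ ⟨e, hc he, h⟩

variable (F) in
/-- The leaf equivalence relation is σ-compact. -/
theorem isSigmaCompact_leafRel [SecondCountableTopology M] [T2Space M] :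
    IsSigmaCompact {p : M × M | p.2 ∈ F.leaf p.1} := by
  obtain ⟨c, hc, hcc, hcov⟩ := F.exists_countable_charts
  have : LocallyCompactSpace M := ChartedSpace.locallyCompactSpace (EuclideanSpace ℝ (Fin (k + q))) M
  have hS : IsSigmaCompact {p : M × M | PlaqueRelIn c p.1 p.2} := by
    have h : {p : M × M | PlaqueRelIn c p.1 p.2} = ⋃ e ∈ c, {p : M × M | PlaqueRel e p.1 p.2} := by
      ext p; simp [PlaqueRelIn]
    rw [h]
    exact isSigmaCompact_biUnion hcc fun e he =>
      isSigmaCompact_plaqueRel (F.target_eq e (hc he))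
  have hn : ∀ n, IsSigmaCompact (plaqueChain c n) := fun n => by
    induction n with
    | zero =>
      have h : plaqueChain c 0 = range fun x : M => (x, x) := by
        ext ⟨x, y⟩
        simp [plaqueChain, eq_comm]
      rw [h]
      exact isSigmaCompact_range (by fun_prop)
    | succ n ih => exact ih.setOf_comp hS
  have h : {p : M × M | p.2 ∈ F.leaf p.1} = ⋃ n, plaqueChain c n := by
    ext ⟨x, y⟩
    simp only [mem_ofPred_eq, mem_iUnion]
    rw [mem_leaf_iff_reflTransGen hc hcov, reflTransGen_iff_exists_plaqueChain]
  rw [h]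
  exact isSigmaCompact_iUnion _ hn

/-- The `e`-plaque of `y` meets only countably many plaques of `c`, and `D` contains a
representative of each: locally the `e`-plaque lies in one plaque of `e'`, and second countability
reduces to countably many neighbourhoods. -/
theorem exists_countable_forall_plaqueRel [SecondCountableTopology M] (hc : c ⊆ F.charts)
    (hcc : c.Countable)
    {e : OpenPartialHomeomorph M (EuclideanSpace ℝ (Fin k) × EuclideanSpace ℝ (Fin q))}
    (he : e ∈ F.charts) (y : M) :
    ∃ D : Set M, D.Countable ∧ (∀ d ∈ D, PlaqueRel e y d) ∧
      ∀ z w, PlaqueRel e y z → PlaqueRelIn c z w → ∃ d ∈ D, PlaqueRelIn c d w := by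
  have h1 : ∀ e' ∈ c, ∃ D : Set M, D.Countable ∧ (∀ d ∈ D, PlaqueRel e y d) ∧
      ∀ z w, PlaqueRel e y z → PlaqueRel e' z w → ∃ d ∈ D, PlaqueRel e' d w := by
    intro e' he'
    have h2 : ∀ z ∈ e.source ∩ e'.source, ∃ W ∈ 𝓝 z, W ⊆ e.source ∩ e'.source ∧
      ∀ w ∈ W, ∀ w' ∈ W, (e w).2 = (e w').2 → (e' w).2 = (e' w').2 :=
      F.compatible e he e' (hc he')
    choose! W hW hWs hWc using h2
    obtain ⟨D, hD, hDc, hDcov⟩ := TopologicalSpace.countable_cover_nhdsWithin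
      (s := {z | PlaqueRel e y z ∧ z ∈ e'.source}) (f := W)
      (fun z hz => mem_nhdsWithin_of_mem_nhds (hW z ⟨hz.1.2.1, hz.2⟩))
    refine ⟨D, hDc, fun d hd => (hD hd).1, fun z w hz hzw => ?_⟩
    obtain ⟨d, hd, hzd⟩ := mem_iUnion₂.1 (hDcov ⟨hz, hzw.1⟩)
    have hd' := hD hd
    have hdd : d ∈ e.source ∩ e'.source := ⟨hd'.1.2.1, hd'.2⟩
    exact ⟨d, hd, PlaqueRel.trans ⟨hd'.2, hzw.1, hWc d hdd d (mem_of_mem_nhds (hW d hdd)) z hzd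
      (hd'.1.2.2.symm.trans hz.2.2)⟩ hzw⟩
  choose! D hDc hDp hD using h1
  refine ⟨⋃ e' ∈ c, D e', hcc.biUnion hDc, fun d hd => ?_, fun z w hz ⟨e', he', hzw⟩ => ?_⟩
  · obtain ⟨e', he', hd⟩ := mem_iUnion₂.1 hd
    exact hDp e' he' d hd
  · obtain ⟨d, hd, hdw⟩ := hD e' he' z w hz hzw
    exact ⟨d, mem_iUnion₂.2 ⟨e', he', hd⟩, e', he', hdw⟩

/-- A leaf is a countable union of plaques. -/
theorem exists_countable_leaf_subset [SecondCountableTopology M] (hc : c ⊆ F.charts)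
    (hcc : c.Countable) (hcov : ∀ x, ∃ e ∈ c, x ∈ e.source) (x : M) :
    ∃ D : Set M, D.Countable ∧ D ⊆ F.leaf x ∧ ∀ z ∈ F.leaf x, ∃ d ∈ D, PlaqueRelIn c d z := by
  have h : ∀ n, ∃ D : Set M, D.Countable ∧ D ⊆ F.leaf x ∧
      ∀ z w, (x, z) ∈ plaqueChain c n → PlaqueRelIn c z w → ∃ d ∈ D, PlaqueRelIn c d w := by
    intro n
    induction n with
    | zero =>
      refine ⟨{x}, countable_singleton x, singleton_subset_iff.2 (F.mem_leaf_self x), ?_⟩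
      intro z w hz hzw
      obtain rfl : x = z := hz
      exact ⟨x, rfl, hzw⟩
    | succ n ih =>
      obtain ⟨D, hDc, hDx, hD⟩ := ih
      choose! D' hDc' hDp' hD' using fun e (he : e ∈ c) =>
        exists_countable_forall_plaqueRel hc hcc (hc he)
      refine ⟨⋃ d ∈ D, ⋃ e ∈ c, D' e d, hDc.biUnion fun d _ => hcc.biUnion fun e he =>
        hDc' e he d, ?_, ?_⟩
      · intro b hb
        simp only [mem_iUnion] at hb
        obtain ⟨d, hd, e, he, hb⟩ := hb
        rw [← F.leaf_eq_of_mem (hDx hd)]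
        exact mem_leaf_of_plaqueRelIn hc ⟨e, he, hDp' e he d b hb⟩
      · rintro z w ⟨z', hz', hzz'⟩ hzw
        obtain ⟨d, hd, e, he, hdz⟩ := hD z' z hz' hzz'
        obtain ⟨b, hb, hbw⟩ := hD' e he d z w hdz hzw
        exact ⟨b, mem_iUnion₂.2 ⟨d, hd, mem_iUnion₂.2 ⟨e, he, hb⟩⟩, hbw⟩
  choose D hDc hDx hD using h
  refine ⟨⋃ n, D n, countable_iUnion hDc, iUnion_subset hDx, fun z hz => ?_⟩
  obtain ⟨n, hn⟩ := reflTransGen_iff_exists_plaqueChain.1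
    ((mem_leaf_iff_reflTransGen hc hcov).1 hz)
  -- A trivial last step from `z` to itself puts `z` on a plaque with representative in `D n`.
  obtain ⟨e, he, hze⟩ := hcov z
  obtain ⟨d, hd, hdz⟩ := hD n z z hn ⟨e, he, hze, hze, rfl⟩
  exact ⟨d, mem_iUnion.2 ⟨n, hd⟩, hdz⟩

end SmoothFoliation

/-! ### Fubini for null sets -/

section ProductNull

variable {α β : Type*} [MeasurableSpace α] [MeasurableSpace β] {μ : Measure α} {ν : Measure β}
  [SFinite μ] [SFinite ν]

theorem MeasureTheory.Measure.ae_measure_slice_snd_eq_zero {s : Set (α × β)}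
    (hs : μ.prod ν s = 0) : ∀ᵐ y ∂ν, μ {x | (x, y) ∈ s} = 0 := by
  have h : ν.prod μ (Prod.swap ⁻¹' s) = 0 :=
    Measure.measurePreserving_swap.quasiMeasurePreserving.preimage_null hs
  exact Measure.measure_ae_null_of_prod_null h

theorem MeasureTheory.Measure.prod_eq_zero_of_ae_slice_snd {s : Set (α × β)}
    (hs : MeasurableSet s) (h : ∀ᵐ y ∂ν, μ {x | (x, y) ∈ s} = 0) : μ.prod ν s = 0 := by
  rw [Measure.prod_apply_symm hs, lintegral_eq_zero_iff (measurable_measure_prodMk_right hs)]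
  exact h

/-- The projection to the second factor of an open set does not hide null sets. -/
theorem MeasureTheory.Measure.eq_zero_of_prod_inter_isOpen [TopologicalSpace α]
    [TopologicalSpace β] [μ.IsOpenPosMeasure] {O : Set (α × β)} (hO : IsOpen O) {Z : Set β}
    (hZ : ∀ t ∈ Z, ∃ s, (s, t) ∈ O) (h : μ.prod ν (O ∩ Prod.snd ⁻¹' Z) = 0) : ν Z = 0 := by
  -- Over `t ∈ Z` the whole slice of `O` is a nonempty open set, so of positive measure. This
  -- direction of Fubini needs no measurability of `Z`.
  refine measure_mono_null (fun t ht => ?_) (ae_iff.1 (Measure.ae_measure_slice_snd_eq_zero h))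
  have hopen : IsOpen {s | (s, t) ∈ O} := hO.preimage (by fun_prop)
  have hset : {s | (s, t) ∈ O ∩ Prod.snd ⁻¹' Z} = {s | (s, t) ∈ O} := by
    ext s; simp [ht]
  change ¬ _ = 0
  rw [hset]
  exact (hopen.measure_pos μ (hZ t ht)).ne'

end ProductNull

/-! ### Null sets of `M` and null sets of leaves -/

namespace SmoothFoliation

variable {k q : ℕ} {M : Type*} [EMetricSpace M]
  [ChartedSpace (EuclideanSpace ℝ (Fin (k + q))) M] [IsManifold (𝓡 (k + q)) ∞ M]
  [RiemannianBundle (fun x : M => TangentSpace (𝓡 (k + q)) x)]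
  [IsContMDiffRiemannianBundle (𝓡 (k + q)) ∞ (EuclideanSpace ℝ (Fin (k + q)))
    (fun x : M => TangentSpace (𝓡 (k + q)) x)]
variable (k q M) in
theorem isContinuousRiemannianBundle_of_contMDiff : IsContinuousRiemannianBundle
    (EuclideanSpace ℝ (Fin (k + q))) (fun x : M => TangentSpace (𝓡 (k + q)) x) := by
  obtain ⟨g, hg, hg'⟩ := IsContMDiffRiemannianBundle.exists_contMDiff (IB := 𝓡 (k + q)) (n := ∞)
    (F := EuclideanSpace ℝ (Fin (k + q))) (E := fun x : M => TangentSpace (𝓡 (k + q)) x)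
  exact ⟨g, hg.continuous, hg'⟩

variable [IsRiemannianManifold (𝓡 (k + q)) M] {F : SmoothFoliation k q M}
  {e : OpenPartialHomeomorph M (EuclideanSpace ℝ (Fin k) × EuclideanSpace ℝ (Fin q))}

theorem exists_lipschitzOnWith_chart (he : e ∈ F.charts) {x : M} (hx : x ∈ e.source) :
    ∃ C : NNReal, ∃ s ∈ 𝓝 x, LipschitzOnWith C e s := by
  have h := (F.contMDiffOn e he).contMDiffAt (e.open_source.mem_nhds hx)
  have := isContinuousRiemannianBundle_of_contMDiff k q M
  exact (h.of_le (by simp)).exists_lipschitzOnWith_of_riemannian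

theorem exists_lipschitzOnWith_chart_symm (he : e ∈ F.charts)
    (v : EuclideanSpace ℝ (Fin k) × EuclideanSpace ℝ (Fin q)) :
    ∃ C : NNReal, ∃ s ∈ 𝓝 v, LipschitzOnWith C e.symm s := by
  have hv : v ∈ e.target := F.target_eq e he ▸ mem_univ v
  have h := (F.contMDiffOn_symm e he).contMDiffAt (e.open_target.mem_nhds hv)
  have := isContinuousRiemannianBundle_of_contMDiff k q M
  exact (h.of_le (by simp)).exists_lipschitzOnWith_to_riemannian

variable [SecondCountableTopology M] [MeasurableSpace M] [BorelSpace M]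

/-- Chart and inverse are both locally Lipschitz, so they preserve null sets; no density or Jacobian
is needed. -/
theorem volume_image_chart_eq_zero_iff (he : e ∈ F.charts) {N : Set M} (hN : N ⊆ e.source) :
    volume (e '' N) = 0 ↔ F.volM N = 0 := by
  rw [← euclideanHausdorffMeasure_prod_eq_zero_iff]
  constructor
  · intro h
    have h1 := euclideanHausdorffMeasure_image_eq_zero (f := e.symm)
      (fun v _ => exists_lipschitzOnWith_chart_symm he v) h
    have himg : e.symm '' (e '' N) = N := e.toPartialEquiv.symm_image_image_of_subset_source hN
    rwa [himg] at h1
  · exact euclideanHausdorffMeasure_image_eq_zero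
      (fun x hx => exists_lipschitzOnWith_chart he (hN hx))

theorem euclideanHausdorffMeasure_image_plaque_eq_zero_iff (he : e ∈ F.charts)
    (A : Set (EuclideanSpace ℝ (Fin k))) (t : EuclideanSpace ℝ (Fin q)) :
    μHE[k] ((fun s => e.symm (s, t)) '' A) = 0 ↔ volume A = 0 := by
  have htar : ∀ v, v ∈ e.target := fun v => F.target_eq e he ▸ mem_univ v
  rw [← EuclideanSpace.euclideanHausdorffMeasure_eq_volume]
  constructor
  · intro h
    have h1 := euclideanHausdorffMeasure_image_eq_zero (f := fun x => (e x).1) ?_ h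
    · rw [image_image] at h1
      have h2 : ∀ s, (e (e.symm (s, t))).1 = s := fun s => by rw [e.right_inv (htar _)]
      simpa only [h2, image_id'] using h1
    · rintro _ ⟨s, _, rfl⟩
      obtain ⟨C, u, hu, hC⟩ := exists_lipschitzOnWith_chart he (e.map_target (htar (s, t)))
      exact ⟨1 * C, u, hu, LipschitzWith.prod_fst.comp_lipschitzOnWith hC⟩
  · refine euclideanHausdorffMeasure_image_eq_zero fun s _ => ?_
    obtain ⟨C, u, hu, hC⟩ := exists_lipschitzOnWith_chart_symm he (s, t)
    have hcont : Continuous fun s : EuclideanSpace ℝ (Fin k) => (s, t) := by fun_prop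
    exact ⟨C * 1, (fun s => (s, t)) ⁻¹' u, hcont.continuousAt.preimage_mem_nhds hu,
      hC.comp (LipschitzWith.prodMk_right t).lipschitzOnWith (mapsTo_preimage _ _)⟩

/-- It gives compact sets finite measure and makes inner approximation by compact sets available. -/
instance isLocallyFiniteMeasure_volM : IsLocallyFiniteMeasure F.volM where
  finiteAtNhds x := by
    obtain ⟨e, he, hx⟩ := F.cover x
    obtain ⟨C, u, hu, hC⟩ := exists_lipschitzOnWith_chart_symm he (e x)
    have hB : Metric.closedBall (e x) 1 ∈ 𝓝 (e x) := Metric.closedBall_mem_nhds _ one_pos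
    have hmem := (e.continuousAt hx).preimage_mem_nhds (Filter.inter_mem hu hB)
    refine ⟨e.symm '' (u ∩ Metric.closedBall (e x) 1),
      Filter.mem_of_superset (Filter.inter_mem hmem (e.open_source.mem_nhds hx)) ?_, ?_⟩
    · rintro y ⟨hy, hys⟩
      exact ⟨e y, hy, e.left_inv hys⟩
    · refine ((hC.mono inter_subset_left).euclideanHausdorffMeasure_image_le (k + q)).trans_lt ?_
      have h : (μHE[k + q] : Measure (EuclideanSpace ℝ (Fin k) × EuclideanSpace ℝ (Fin q)))
          |>.IsAddHaarMeasure := by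
        have := isAddHaarMeasure_euclideanHausdorffMeasure
          (E := EuclideanSpace ℝ (Fin k) × EuclideanSpace ℝ (Fin q))
        simpa using this
      refine ENNReal.mul_lt_top (by simp) ((measure_mono inter_subset_right).trans_lt ?_)
      exact (isCompact_closedBall _ _).measure_lt_top

theorem volM_plaques_eq_zero_iff (he : e ∈ F.charts) {Z : Set (EuclideanSpace ℝ (Fin q))} :
    F.volM {y | y ∈ e.source ∧ (e y).2 ∈ Z} = 0 ↔ volume Z = 0 := by
  have himg : e '' {y | y ∈ e.source ∧ (e y).2 ∈ Z} = univ ∩ Prod.snd ⁻¹' Z := by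
    ext v
    constructor
    · rintro ⟨y, hy, rfl⟩; exact ⟨mem_univ _, hy.2⟩
    · intro hv
      have htar : v ∈ e.target := F.target_eq e he ▸ mem_univ v
      refine ⟨e.symm v, ⟨e.map_target htar, ?_⟩, e.right_inv htar⟩
      rw [e.right_inv htar]; exact hv.2
  rw [← volume_image_chart_eq_zero_iff he fun y hy => hy.1, himg, Measure.volume_eq_prod]
  constructor
  · exact Measure.eq_zero_of_prod_inter_isOpen isOpen_univ fun t _ => ⟨0, mem_univ _⟩
  · intro h
    rw [univ_inter, ← univ_prod, Measure.prod_prod, h, mul_zero]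

/-- Passing from the transversal of one chart to the transversal of another preserves null sets. -/
theorem volume_transition_eq_zero (he : e ∈ F.charts)
    {e' : OpenPartialHomeomorph M (EuclideanSpace ℝ (Fin k) × EuclideanSpace ℝ (Fin q))}
    (he' : e' ∈ F.charts) {Z : Set (EuclideanSpace ℝ (Fin q))} (hZ : volume Z = 0) :
    volume {t | ∃ y, y ∈ e.source ∧ y ∈ e'.source ∧ (e y).2 ∈ Z ∧ (e' y).2 = t} = 0 := by
  -- Compatibility is used from `e'` to `e`: within `W` an `e'`-plaque lies in one `e`-plaque. So
  -- once one point of `W` over `t` lies over `Z`, all of them do, and no regularity of the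
  -- transverse transition is needed.
  have h := F.compatible e' he' e he
  choose! W hW hWs hWc using h
  obtain ⟨D, hD, hDc, hcov⟩ := TopologicalSpace.countable_cover_nhdsWithin
    (s := e'.source ∩ e.source) (f := fun z => interior (W z))
    (fun z hz => mem_nhdsWithin_of_mem_nhds (interior_mem_nhds.2 (hW z hz)))
  have hsub : {t | ∃ y, y ∈ e.source ∧ y ∈ e'.source ∧ (e y).2 ∈ Z ∧ (e' y).2 = t} ⊆
      ⋃ d ∈ D, {t | ∃ y ∈ interior (W d), (e y).2 ∈ Z ∧ (e' y).2 = t} := by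
    rintro t ⟨y, hy, hy', hyZ, rfl⟩
    obtain ⟨d, hd, hyd⟩ := mem_iUnion₂.1 (hcov ⟨hy', hy⟩)
    exact mem_iUnion₂.2 ⟨d, hd, y, hyd, hyZ, rfl⟩
  refine measure_mono_null hsub ((measure_biUnion_null_iff hDc).2 fun d hd => ?_)
  have hWd : interior (W d) ⊆ e'.source ∩ e.source := interior_subset.trans (hWs d (hD hd))
  have hopen : IsOpen (e' '' interior (W d)) :=
    e'.isOpen_image_of_subset_source isOpen_interior fun y hy => (hWd hy).1
  refine Measure.eq_zero_of_prod_inter_isOpen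
    (μ := (volume : Measure (EuclideanSpace ℝ (Fin k)))) hopen ?_ ?_
  · rintro t ⟨y, hy, _, rfl⟩
    exact ⟨(e' y).1, y, hy, rfl⟩
  · have hnull : volume (e' '' ({y | y ∈ e.source ∧ (e y).2 ∈ Z} ∩ interior (W d))) = 0 := by
      rw [volume_image_chart_eq_zero_iff he' fun y hy => (hWd hy.2).1]
      exact measure_mono_null inter_subset_left ((volM_plaques_eq_zero_iff he).2 hZ)
    refine measure_mono_null ?_ hnull
    rintro _ ⟨⟨y, hy, rfl⟩, ⟨y', hy', hyZ, hyy'⟩⟩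
    refine ⟨y, ⟨⟨(hWd hy).2, ?_⟩, hy⟩, rfl⟩
    rwa [hWc d (hD hd) y (interior_subset hy) y' (interior_subset hy') hyy'.symm]

variable {c : Set (OpenPartialHomeomorph M (EuclideanSpace ℝ (Fin k) × EuclideanSpace ℝ (Fin q)))}

/-- The leaves through a null family of plaques form a null set. -/
theorem volM_saturation_eq_zero (hc : c ⊆ F.charts) (hcc : c.Countable)
    (hcov : ∀ x, ∃ e ∈ c, x ∈ e.source)
    {Z : OpenPartialHomeomorph M (EuclideanSpace ℝ (Fin k) × EuclideanSpace ℝ (Fin q)) →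
      Set (EuclideanSpace ℝ (Fin q))} (hZ : ∀ e ∈ c, volume (Z e) = 0) :
    F.volM {x | ∃ y ∈ F.leaf x, ∃ e ∈ c, y ∈ e.source ∧ (e y).2 ∈ Z e} = 0 := by
  have h : ∀ n, F.volM {x | ∃ y, (x, y) ∈ plaqueChain c n ∧
      ∃ e ∈ c, y ∈ e.source ∧ (e y).2 ∈ Z e} = 0 := by
    intro n
    induction n generalizing Z with
    | zero =>
      have hsub : {x | ∃ y, (x, y) ∈ plaqueChain c 0 ∧ ∃ e ∈ c, y ∈ e.source ∧ (e y).2 ∈ Z e} ⊆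
          ⋃ e ∈ c, {y | y ∈ e.source ∧ (e y).2 ∈ Z e} := by
        rintro x ⟨y, hxy, e, he, hy⟩
        obtain rfl : x = y := hxy
        exact mem_iUnion₂.2 ⟨e, he, hy⟩
      exact measure_mono_null hsub ((measure_biUnion_null_iff hcc).2 fun e he =>
        (volM_plaques_eq_zero_iff (hc he)).2 (hZ e he))
    | succ n ih =>
      -- The last plaque of the chain is absorbed by transporting the bad parameters to every chart,
      -- which keeps them null.
      have hZ' : ∀ e' ∈ c, volume (⋃ e ∈ c,
          {t | ∃ y, y ∈ e.source ∧ y ∈ e'.source ∧ (e y).2 ∈ Z e ∧ (e' y).2 = t}) = 0 :=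
        fun e' he' => (measure_biUnion_null_iff hcc).2 fun e he =>
          volume_transition_eq_zero (hc he) (hc he') (hZ e he)
      refine measure_mono_null ?_ (ih hZ')
      rintro x ⟨y, ⟨y', hxy', e', he', hyy'⟩, e, he, hy, hyZ⟩
      exact ⟨y', hxy', e', he', hyy'.1, mem_iUnion₂.2
        ⟨e, he, y, hy, hyy'.2.1, hyZ, hyy'.2.2.symm⟩⟩
  refine measure_mono_null ?_ (measure_iUnion_null h)
  rintro x ⟨y, hy, hyZ⟩
  obtain ⟨n, hn⟩ := reflTransGen_iff_exists_plaqueChain.1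
    ((mem_leaf_iff_reflTransGen hc hcov).1 hy)
  exact mem_iUnion.2 ⟨n, y, hn, hyZ⟩

/-- A null set meets almost every leaf in a null set of the leaf. -/
theorem ae_euclideanHausdorffMeasure_inter_leaf_eq_zero {N : Set M} (hN : F.volM N = 0) :
    ∀ᵐ x ∂F.volM, μHE[k] (N ∩ F.leaf x) = 0 := by
  obtain ⟨c, hc, hcc, hcov⟩ := F.exists_countable_charts
  let Z := fun e : OpenPartialHomeomorph M
    (EuclideanSpace ℝ (Fin k) × EuclideanSpace ℝ (Fin q)) =>
    {t | μHE[k] (N ∩ {y | y ∈ e.source ∧ (e y).2 = t}) ≠ 0}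
  have hZ : ∀ e ∈ c, volume (Z e) = 0 := by
    intro e he
    have h1 : volume (e '' (N ∩ e.source)) = 0 :=
      (volume_image_chart_eq_zero_iff (hc he) inter_subset_right).2
        (measure_mono_null inter_subset_left hN)
    refine measure_mono_null ?_ (ae_iff.1 (Measure.ae_measure_slice_snd_eq_zero h1))
    intro t ht h2
    refine ht (measure_mono_null ?_
      ((euclideanHausdorffMeasure_image_plaque_eq_zero_iff (hc he) _ t).2 h2))
    rintro y ⟨hyN, hy, rfl⟩
    exact ⟨(e y).1, mem_image_of_mem e ⟨hyN, hy⟩, e.left_inv hy⟩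
  rw [ae_iff]
  refine measure_mono_null (fun x hx => ?_) (volM_saturation_eq_zero hc hcc hcov hZ)
  -- A leaf that avoids all bad plaques is a countable union of plaques, each meeting `N` in a null
  -- set.
  by_contra hcon
  refine hx ?_
  obtain ⟨D, hDc, hDx, hD⟩ := exists_countable_leaf_subset hc hcc hcov x
  have hsub : N ∩ F.leaf x ⊆ ⋃ d ∈ D, ⋃ e ∈ c, N ∩ {y | PlaqueRel e d y} := by
    rintro y ⟨hyN, hy⟩
    obtain ⟨d, hd, e, he, hdy⟩ := hD y hy
    exact mem_iUnion₂.2 ⟨d, hd, mem_iUnion₂.2 ⟨e, he, hyN, hdy⟩⟩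
  refine measure_mono_null hsub ((measure_biUnion_null_iff hDc).2 fun d hd =>
    (measure_biUnion_null_iff hcc).2 fun e he => ?_)
  by_contra hne
  have hde : d ∈ e.source := by
    by_contra hde
    refine hne (measure_mono_null (t := ∅) ?_ measure_empty)
    rintro y ⟨_, hy⟩
    exact hde hy.1
  refine hcon ⟨d, hDx hd, e, he, hde, fun h0 => hne (measure_mono_null ?_ h0)⟩
  rintro y ⟨hyN, hy⟩
  exact ⟨hyN, hy.2.1, hy.2.2.symm⟩

/-- A Borel set that meets almost every leaf in a null set of the leaf is a null set. -/
theorem volM_eq_zero_of_ae_inter_leaf {N : Set M} (hN : MeasurableSet N)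
    (h : ∀ᵐ x ∂F.volM, μHE[k] (N ∩ F.leaf x) = 0) : F.volM N = 0 := by
  obtain ⟨c, hc, hcc, hcov⟩ := F.exists_countable_charts
  have hsub : N ⊆ ⋃ e ∈ c, N ∩ e.source := fun x hx =>
    let ⟨e, he, hxe⟩ := hcov x
    mem_iUnion₂.2 ⟨e, he, hx, hxe⟩
  refine measure_mono_null hsub ((measure_biUnion_null_iff hcc).2 fun e he => ?_)
  have htar : ∀ v, v ∈ e.target := fun v => F.target_eq e (hc he) ▸ mem_univ v
  have hcont : Continuous e.symm := by
    rw [← continuousOn_univ, ← F.target_eq e (hc he)]; exact e.continuousOn_symm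
  have hZ : volume {t | μHE[k] (N ∩ {y | y ∈ e.source ∧ (e y).2 = t}) ≠ 0} = 0 := by
    -- Every point of a plaque meeting `N` in positive measure lies on an exceptional leaf, so these
    -- plaques together form a null set.
    rw [← volM_plaques_eq_zero_iff (hc he)]
    refine measure_mono_null (fun x hx => ?_) (ae_iff.1 h)
    refine fun h0 => hx.2 (measure_mono_null ?_ h0)
    rintro y ⟨hyN, hy, hxy⟩
    exact ⟨hyN, Relation.EqvGen.rel _ _ ⟨e, hc he, hx.1, hy, hxy.symm⟩⟩
  rw [← volume_image_chart_eq_zero_iff (hc he) inter_subset_right]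
  have himg : e '' (N ∩ e.source) = e.symm ⁻¹' N := by
    ext v
    constructor
    · rintro ⟨y, ⟨hyN, hy⟩, rfl⟩
      change e.symm (e y) ∈ N
      rwa [e.left_inv hy]
    · intro hv
      exact ⟨e.symm v, ⟨hv, e.map_target (htar v)⟩, e.right_inv (htar v)⟩
  rw [himg]
  refine Measure.prod_eq_zero_of_ae_slice_snd (hcont.measurable hN) ?_
  rw [ae_iff]
  refine measure_mono_null (fun t ht => ?_) hZ
  refine fun h0 => ht ((euclideanHausdorffMeasure_image_plaque_eq_zero_iff (hc he) _ t).1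
    (measure_mono_null ?_ h0))
  rintro _ ⟨s, hs, rfl⟩
  exact ⟨hs, e.map_target (htar _), by rw [e.right_inv (htar _)]⟩

end SmoothFoliation

/-! ### σ-compact approximation and measurability of leaf integrals -/

theorem IsSigmaCompact.measurableSet {X : Type*} [TopologicalSpace X] [T2Space X]
    [MeasurableSpace X] [OpensMeasurableSpace X] {s : Set X} (hs : IsSigmaCompact s) :
    MeasurableSet s := by
  obtain ⟨K, hK, rfl⟩ := hs
  exact MeasurableSet.iUnion fun n => (hK n).measurableSet

/-- A Borel set is σ-compact up to a null set. -/
theorem MeasurableSet.exists_isSigmaCompact_subset_diff_null {X : Type*} [TopologicalSpace X]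
    [T2Space X] [MeasurableSpace X] [OpensMeasurableSpace X] {μ : Measure X} [SigmaFinite μ]
    [μ.InnerRegularCompactLTTop] {B : Set X} (hB : MeasurableSet B) :
    ∃ S ⊆ B, IsSigmaCompact S ∧ μ (B \ S) = 0 := by
  have h : ∀ n m : ℕ, ∃ K ⊆ B ∩ spanningSets μ n, IsCompact K ∧
      μ ((B ∩ spanningSets μ n) \ K) < ((m : ℝ≥0∞) + 1)⁻¹ := fun n m =>
    (hB.inter (measurableSet_spanningSets μ n)).exists_isCompact_sdiff_lt
      ((measure_mono inter_subset_right).trans_lt (measure_spanningSets_lt_top μ n)).ne (by simp)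
  choose K hKB hKc hK using h
  refine ⟨⋃ i : ℕ × ℕ, K i.1 i.2, iUnion_subset fun i => (hKB _ _).trans inter_subset_left,
    isSigmaCompact_iUnion_of_isCompact _ fun i => hKc _ _, ?_⟩
  have hsub : B \ ⋃ i : ℕ × ℕ, K i.1 i.2 ⊆ ⋃ n, ⋂ m, (B ∩ spanningSets μ n) \ K n m := by
    rintro x ⟨hx, hxK⟩
    have hx' : x ∈ ⋃ n, spanningSets μ n := iUnion_spanningSets μ ▸ mem_univ x
    obtain ⟨n, hn⟩ := mem_iUnion.1 hx'
    exact mem_iUnion.2 ⟨n, mem_iInter.2 fun m => ⟨⟨hx, hn⟩, fun h =>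
      hxK (mem_iUnion.2 ⟨(n, m), h⟩)⟩⟩
  refine measure_mono_null hsub (measure_iUnion_null fun n => ?_)
  refine le_antisymm (le_of_forall_gt fun ε hε => ?_) zero_le
  obtain ⟨m, hm⟩ := ENNReal.exists_inv_nat_lt hε.ne'
  calc μ (⋂ m, (B ∩ spanningSets μ n) \ K n m) ≤ μ ((B ∩ spanningSets μ n) \ K n m) :=
        measure_mono (iInter_subset _ m)
    _ < ((m : ℝ≥0∞) + 1)⁻¹ := hK n m
    _ ≤ (m : ℝ≥0∞)⁻¹ := ENNReal.inv_le_inv.2 le_self_add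
    _ < ε := hm

namespace SmoothFoliation

variable {k q : ℕ} {M : Type*} [EMetricSpace M]
  [ChartedSpace (EuclideanSpace ℝ (Fin (k + q))) M]
  [SecondCountableTopology M] [MeasurableSpace M] [BorelSpace M]
  {F : SmoothFoliation k q M}

variable (F) in
theorem measurableSet_leaf (x : M) : MeasurableSet (F.leaf x) :=
  (F.isSigmaCompact_leafRel.slice x).measurableSet

theorem ae_volLeaf_mem_leaf (x : M) : ∀ᵐ y ∂F.volLeaf (F.leaf x), y ∈ F.leaf x :=
  ae_restrict_mem (F.measurableSet_leaf x)

theorem volLeaf_eq_inter (x : M) (N : Set M) :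
    F.volLeaf (F.leaf x) N = μHE[k] (N ∩ F.leaf x) :=
  Measure.restrict_apply' (F.measurableSet_leaf x)

/-- The value is the Hausdorff measure of a slice of the leaf relation intersected with `M × S`,
which is again σ-compact. -/
theorem measurable_volLeaf_of_isSigmaCompact {S : Set M} (hS : IsSigmaCompact S) :
    Measurable fun x => F.volLeaf (F.leaf x) S := by
  obtain ⟨K, hK, rfl⟩ := hS
  have h : IsSigmaCompact {p : M × M | p.2 ∈ (⋃ n, K n) ∩ F.leaf p.1} := by
    have h1 : {p : M × M | p.2 ∈ (⋃ n, K n) ∩ F.leaf p.1} =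
        ⋃ n, {p : M × M | p.2 ∈ F.leaf p.1} ∩ Prod.snd ⁻¹' K n := by
      ext p
      simp [and_comm]
    rw [h1]
    exact isSigmaCompact_iUnion _ fun n =>
      F.isSigmaCompact_leafRel.inter_isClosed ((hK n).isClosed.preimage continuous_snd)
  simp_rw [volLeaf_eq_inter]
  exact h.measurable_euclideanHausdorffMeasure_slice k

variable [IsManifold (𝓡 (k + q)) ∞ M]
  [RiemannianBundle (fun x : M => TangentSpace (𝓡 (k + q)) x)]
  [IsContMDiffRiemannianBundle (𝓡 (k + q)) ∞ (EuclideanSpace ℝ (Fin (k + q)))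
    (fun x : M => TangentSpace (𝓡 (k + q)) x)]
  [IsRiemannianManifold (𝓡 (k + q)) M]

theorem ae_ae_volLeaf {P : M → Prop} (h : ∀ᵐ y ∂F.volM, P y) :
    ∀ᵐ x ∂F.volM, ∀ᵐ y ∂F.volLeaf (F.leaf x), P y := by
  filter_upwards [ae_euclideanHausdorffMeasure_inter_leaf_eq_zero (ae_iff.1 h)] with x hx
  rwa [ae_iff, volLeaf_eq_inter]

variable (F) in
theorem exists_isSigmaCompact_subset_diff_volM_null {B : Set M} (hB : MeasurableSet B) :
    ∃ S ⊆ B, IsSigmaCompact S ∧ F.volM (B \ S) = 0 := by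
  have : LocallyCompactSpace M := ChartedSpace.locallyCompactSpace (EuclideanSpace ℝ (Fin (k + q))) M
  exact hB.exists_isSigmaCompact_subset_diff_null

/-- The integral over the leaf through `x` agrees almost everywhere with a Borel function of `x`
that is constant on the leaves. -/
theorem exists_measurable_lintegral_volLeaf {f : M → ℝ≥0∞} (hf : AEMeasurable f F.volM) :
    ∃ J : M → ℝ≥0∞, Measurable J ∧ (∀ x, ∀ y ∈ F.leaf x, J y = J x) ∧
      ∀ᵐ x ∂F.volM, ∫⁻ y, f y ∂F.volLeaf (F.leaf x) = J x := by
  have key : ∀ g : M → ℝ≥0∞, Measurable g → ∃ J : M → ℝ≥0∞, Measurable J ∧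
      (∀ x, ∀ y ∈ F.leaf x, J y = J x) ∧
        ∀ᵐ x ∂F.volM, ∫⁻ y, g y ∂F.volLeaf (F.leaf x) = J x := by
    intro g hg
    refine Measurable.ennreal_induction (motive := fun g => ∃ J : M → ℝ≥0∞, Measurable J ∧
      (∀ x, ∀ y ∈ F.leaf x, J y = J x) ∧
        ∀ᵐ x ∂F.volM, ∫⁻ y, g y ∂F.volLeaf (F.leaf x) = J x) ?_ ?_ ?_ hg
    · intro c s hs
      -- A Borel set is traded for a σ-compact subset; the difference is null on almost every leaf,
      -- and the new value depends on the leaf alone.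
      obtain ⟨S, hSs, hS, hnull⟩ := F.exists_isSigmaCompact_subset_diff_volM_null hs
      refine ⟨fun x => c * F.volLeaf (F.leaf x) S,
        (measurable_volLeaf_of_isSigmaCompact hS).const_mul c,
        fun x y hy => by simp only [F.leaf_eq_of_mem hy], ?_⟩
      filter_upwards [ae_euclideanHausdorffMeasure_inter_leaf_eq_zero hnull] with x hx
      rw [lintegral_indicator_const hs]
      congr 1
      refine le_antisymm ?_ (measure_mono hSs)
      rw [← volLeaf_eq_inter] at hx
      calc F.volLeaf (F.leaf x) s ≤ F.volLeaf (F.leaf x) (S ∪ s \ S) :=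
            measure_mono (by rw [union_sdiff_self]; exact subset_union_right)
        _ ≤ F.volLeaf (F.leaf x) S + F.volLeaf (F.leaf x) (s \ S) := measure_union_le _ _
        _ = _ := by rw [hx, add_zero]
    · intro f g _ hf _ ihf ihg
      obtain ⟨J, hJ, hJl, hJe⟩ := ihf
      obtain ⟨J', hJ', hJl', hJe'⟩ := ihg
      refine ⟨J + J', hJ.add hJ', fun x y hy => ?_, ?_⟩
      · simp only [Pi.add_apply, hJl x y hy, hJl' x y hy]
      · filter_upwards [hJe, hJe'] with x h1 h2
        simp only [Pi.add_apply]
        rw [lintegral_add_left hf, h1, h2]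
    · intro f hf hmono ih
      choose J hJ hJl hJe using ih
      refine ⟨fun x => ⨆ n, J n x, Measurable.iSup hJ, fun x y hy => ?_, ?_⟩
      · simp only [hJl _ x y hy]
      · filter_upwards [ae_all_iff.2 hJe] with x hx
        rw [lintegral_iSup hf hmono]
        simp only [hx]
  obtain ⟨J, hJ, hJl, hJe⟩ := key (hf.mk f) hf.measurable_mk
  refine ⟨J, hJ, hJl, ?_⟩
  filter_upwards [hJe, ae_ae_volLeaf hf.ae_eq_mk] with x h1 h2
  rw [← h1]
  exact lintegral_congr_ae h2

end SmoothFoliation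

/-! ### Variations of an extremal function -/

/-- A finite `a` with `a ≤ (1 - ε) ^ p * a + ε ^ p * b` for all `ε ∈ (0, 1)` vanishes if `1 < p`. -/
theorem ENNReal.eq_zero_of_forall_le_rpow_mul {p : ℝ} (hp : 1 < p) {a b : ℝ≥0∞} (ha : a ≠ ⊤)
    (hb : b ≠ ⊤)
    (h : ∀ ε : ℝ, 0 < ε → ε < 1 →
      a ≤ ENNReal.ofReal (1 - ε) ^ p * a + ENNReal.ofReal ε ^ p * b) : a = 0 := by
  lift a to NNReal using ha
  lift b to NNReal using hb
  -- From `(1 - ε) ^ p ≤ 1 - ε` one gets `ε a ≤ ε ^ p b`; dividing by `ε` leaves a power `p - 1 > 0`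
  -- that tends to 0.
  have h1 : ∀ ε : ℝ, 0 < ε → ε < 1 → (a : ℝ) ≤ ε ^ (p - 1) * b := by
    intro ε hε hε1
    have h2 := h ε hε hε1
    have hε' : 0 ≤ 1 - ε := by linarith
    rw [ENNReal.ofReal_rpow_of_nonneg hε' (by linarith),
      ENNReal.ofReal_rpow_of_nonneg hε.le (by linarith), ← ENNReal.ofReal_coe_nnreal (p := a),
      ← ENNReal.ofReal_coe_nnreal (p := b), ← ENNReal.ofReal_mul (by positivity),
      ← ENNReal.ofReal_mul (by positivity), ← ENNReal.ofReal_add (by positivity) (by positivity),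
      ENNReal.ofReal_le_ofReal_iff (by positivity)] at h2
    have h3 : (1 - ε) ^ p ≤ 1 - ε := by
      simpa using Real.rpow_le_rpow_of_exponent_ge' hε' (by linarith) zero_le_one hp.le
    have h4 : ε ^ p = ε * ε ^ (p - 1) := by
      rw [← Real.rpow_one_add' hε.le (by linarith)]; ring_nf
    rw [h4] at h2
    have h5 : (1 - ε) ^ p * a ≤ (1 - ε) * a := mul_le_mul_of_nonneg_right h3 a.2
    have h6 : ε * (a : ℝ) ≤ ε * (ε ^ (p - 1) * b) := by linarith
    exact le_of_mul_le_mul_left h6 hε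
  have hlim : Filter.Tendsto (fun ε : ℝ => ε ^ (p - 1) * (b : ℝ)) (𝓝[>] 0) (𝓝 (0 * b)) := by
    refine Filter.Tendsto.mul_const _ (Filter.Tendsto.mono_left ?_ nhdsWithin_le_nhds)
    have := (Real.continuousAt_rpow_const 0 (p - 1) (Or.inr (by linarith))).tendsto
    rwa [Real.zero_rpow (by linarith)] at this
  rw [zero_mul] at hlim
  have h0 : (a : ℝ) ≤ 0 := by
    refine ge_of_tendsto hlim ?_
    filter_upwards [Ioo_mem_nhdsGT one_pos] with ε hε using h1 ε hε.1 hε.2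
  have : a = 0 := le_antisymm (by exact_mod_cast h0) zero_le
  simp [this]

namespace SmoothFoliation

section Admissible

variable {k q : ℕ} {M : Type*} [EMetricSpace M]
  [ChartedSpace (EuclideanSpace ℝ (Fin (k + q))) M] [MeasurableSpace M] [BorelSpace M]
  {F : SmoothFoliation k q M} {p : ℝ} {f₀ f₁ : M → ℝ}

theorem IsAdmissible.lintegral_rpow_ne_top (hp : 0 < p) (hf : F.IsAdmissible p f₀) :
    ∫⁻ x, ‖f₀ x‖ₑ ^ p ∂F.volM ≠ ⊤ := by
  have h := lintegral_rpow_enorm_lt_top_of_eLpNorm_lt_top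
    (ENNReal.ofReal_pos.2 hp).ne' ENNReal.ofReal_ne_top hf.memLp.2
  rw [ENNReal.toReal_ofReal hp.le] at h
  exact h.ne

theorem IsExtremal.lintegral_rpow_le (hp : 0 < p) (hf₀ : F.IsExtremal p f₀)
    (hf₁ : F.IsAdmissible p f₁) :
    ∫⁻ x, ‖f₀ x‖ₑ ^ p ∂F.volM ≤ ∫⁻ x, ‖f₁ x‖ₑ ^ p ∂F.volM := by
  have h : eLpNorm f₀ (ENNReal.ofReal p) F.volM ≤ eLpNorm f₁ (ENNReal.ofReal p) F.volM := by
    rw [← hf₀.modulus_eq]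
    exact iInf₂_le f₁ hf₁
  have hp0 : ENNReal.ofReal p ≠ 0 := (ENNReal.ofReal_pos.2 hp).ne'
  rw [eLpNorm_eq_lintegral_rpow_enorm_toReal hp0 ENNReal.ofReal_ne_top,
    eLpNorm_eq_lintegral_rpow_enorm_toReal hp0 ENNReal.ofReal_ne_top,
    ENNReal.toReal_ofReal hp.le] at h
  exact (ENNReal.rpow_le_rpow_iff (one_div_pos.2 hp)).1 h

end Admissible

variable {k q : ℕ} {M : Type*} [EMetricSpace M]
  [ChartedSpace (EuclideanSpace ℝ (Fin (k + q))) M] [IsManifold (𝓡 (k + q)) ∞ M]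
  [SecondCountableTopology M]
  [RiemannianBundle (fun x : M => TangentSpace (𝓡 (k + q)) x)]
  [IsContMDiffRiemannianBundle (𝓡 (k + q)) ∞ (EuclideanSpace ℝ (Fin (k + q)))
    (fun x : M => TangentSpace (𝓡 (k + q)) x)]
  [IsRiemannianManifold (𝓡 (k + q)) M]
  [MeasurableSpace M] [BorelSpace M]
  {F : SmoothFoliation k q M} {p : ℝ} {f₀ f₁ : M → ℝ}

/-- Admissible functions form a convex set. -/
theorem IsAdmissible.convexComb (hf₀ : F.IsAdmissible p f₀) (hf₁ : F.IsAdmissible p f₁) {ε : ℝ}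
    (hε : 0 ≤ ε) (hε1 : ε ≤ 1) : F.IsAdmissible p fun x => (1 - ε) * f₀ x + ε * f₁ x where
  memLp := (hf₀.memLp.const_mul _).add (hf₁.memLp.const_mul _)
  nonneg := by
    filter_upwards [hf₀.nonneg, hf₁.nonneg] with x h0 h1
    have := sub_nonneg.2 hε1
    positivity
  one_le := by
    filter_upwards [hf₀.one_le, hf₁.one_le, ae_ae_volLeaf hf₀.nonneg,
      ae_ae_volLeaf hf₁.nonneg] with x h0 h1 hn0 hn1
    have hε' := sub_nonneg.2 hε1
    calc (1 : ℝ≥0∞) = ENNReal.ofReal (1 - ε) * 1 + ENNReal.ofReal ε * 1 := by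
          rw [mul_one, mul_one, ← ENNReal.ofReal_add hε' hε]; simp
      _ ≤ ENNReal.ofReal (1 - ε) * F.leafIntegral f₀ (F.leaf x) +
          ENNReal.ofReal ε * F.leafIntegral f₁ (F.leaf x) := by gcongr
      _ ≤ ∫⁻ y, (ENNReal.ofReal (1 - ε) * ENNReal.ofReal (f₀ y) +
          ENNReal.ofReal ε * ENNReal.ofReal (f₁ y)) ∂F.volLeaf (F.leaf x) :=
        (add_le_add (lintegral_const_mul_le _ _) (lintegral_const_mul_le _ _)).trans
          (le_lintegral_add _ _)
      _ = F.leafIntegral (fun x => (1 - ε) * f₀ x + ε * f₁ x) (F.leaf x) := by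
        refine lintegral_congr_ae ?_
        filter_upwards [hn0, hn1] with y h0 h1
        rw [ENNReal.ofReal_add (by positivity) (by positivity), ENNReal.ofReal_mul hε',
          ENNReal.ofReal_mul hε]

/-- The competitor is `f₀` divided by its truncated leaf integral: it is admissible and nowhere
larger in absolute value, so minimality makes the two agree almost everywhere. -/
theorem IsExtremal.ae_leafIntegral_eq_one (hp : 1 < p) (hf₀ : F.IsExtremal p f₀) :
    F.AlmostEveryLeaf fun L => F.leafIntegral f₀ L = 1 := by
  have hp0 : 0 < p := one_pos.trans hp
  have hadm := hf₀.isAdmissible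
  obtain ⟨J, hJ, hJl, hJe⟩ := exists_measurable_lintegral_volLeaf (F := F)
    hadm.memLp.1.aemeasurable.ennreal_ofReal
  -- The cap 2 keeps the weight positive on leaves of infinite integral, where dividing by `J`
  -- itself would give 0. The floor 1 makes the weight at most 1 on the exceptional leaves too.
  set θ : M → ℝ≥0∞ := fun x => max 1 (min (J x) 2) with hθ
  have hθm : Measurable θ := measurable_const.max (hJ.min measurable_const)
  have hθ1 : ∀ x, 1 ≤ θ x := fun x => le_max_left _ _
  have hθ0 : ∀ x, θ x ≠ 0 := fun x => (one_pos.trans_le (hθ1 x)).ne'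
  have hθt : ∀ x, θ x ≠ ⊤ := fun x =>
    ((max_le (by norm_num) (min_le_right _ _) : θ x ≤ 2).trans_lt (by simp)).ne
  set w : M → ℝ := fun x => (θ x)⁻¹.toReal with hw
  have hwm : Measurable w := hθm.inv.ennreal_toReal
  have hw0 : ∀ x, 0 ≤ w x := fun x => ENNReal.toReal_nonneg
  have hwof : ∀ x, ENNReal.ofReal (w x) = (θ x)⁻¹ := fun x =>
    ENNReal.ofReal_toReal (ENNReal.inv_ne_top.2 (hθ0 x))
  have hw1 : ∀ x, w x ≤ 1 := fun x => by
    rw [← ENNReal.ofReal_le_ofReal_iff zero_le_one, hwof, ENNReal.ofReal_one]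
    exact ENNReal.inv_le_one.2 (hθ1 x)
  have hle : ∀ x, ‖w x * f₀ x‖ ≤ ‖f₀ x‖ := fun x => by
    rw [norm_mul, Real.norm_of_nonneg (hw0 x)]
    exact mul_le_of_le_one_left (norm_nonneg _) (hw1 x)
  have hf₁ : F.IsAdmissible p fun x => w x * f₀ x := by
    refine ⟨hadm.memLp.of_le (hwm.aestronglyMeasurable.mul hadm.memLp.1)
      (Filter.Eventually.of_forall hle), ?_, ?_⟩
    · filter_upwards [hadm.nonneg] with x hx
      exact mul_nonneg (hw0 x) hx
    · filter_upwards [hadm.one_le, hJe] with x h1 hJx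
      have hint : F.leafIntegral (fun x => w x * f₀ x) (F.leaf x) = (θ x)⁻¹ * J x := by
        rw [← hJx, ← lintegral_const_mul' _ _ (ENNReal.inv_ne_top.2 (hθ0 x))]
        refine lintegral_congr_ae ?_
        filter_upwards [ae_volLeaf_mem_leaf x] with y hy
        rw [ENNReal.ofReal_mul (hw0 y), hwof]
        simp only [hθ, hJl x y hy]
      have hJ1 : 1 ≤ J x := hJx ▸ h1
      rw [hint, mul_comm, ← div_eq_mul_inv, ENNReal.le_div_iff_mul_le (Or.inl (hθ0 x))
        (Or.inl (hθt x)), one_mul]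
      exact max_le hJ1 (min_le_left _ _)
  have hae : (fun x => ‖w x * f₀ x‖ₑ ^ p) =ᵐ[F.volM] fun x => ‖f₀ x‖ₑ ^ p := by
    refine ae_eq_of_ae_le_of_lintegral_le (Filter.Eventually.of_forall fun x => ?_)
      (hf₁.lintegral_rpow_ne_top hp0) (hadm.memLp.1.enorm.pow_const p)
      (hf₀.lintegral_rpow_le hp0 hf₁)
    exact ENNReal.rpow_le_rpow (enorm_le_iff_norm_le.2 (hle x)) hp0.le
  have hzero : ∀ᵐ x ∂F.volM, 1 < J x → f₀ x = 0 := by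
    filter_upwards [hae] with x hx hJx
    by_contra hne
    have h1 : ‖w x * f₀ x‖ₑ = ‖f₀ x‖ₑ := ENNReal.rpow_left_injective hp0.ne' hx
    rw [enorm_mul] at h1
    have h2 : ‖w x‖ₑ = 1 := by
      have h3 : ‖f₀ x‖ₑ ≠ 0 := by simpa using hne
      exact (ENNReal.mul_eq_right h3 enorm_ne_top).1 h1
    rw [Real.enorm_of_nonneg (hw0 x), hwof, ENNReal.inv_eq_one] at h2
    have h3 : 1 < min (J x) 2 := lt_min hJx (by norm_num)
    exact (h3.trans_le (le_max_right _ _)).ne' h2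
  -- `J` is constant on a leaf, so if `J > 1` there, `f₀` vanishes almost everywhere on the leaf and
  -- its integral is 0, not at least 1.
  filter_upwards [hadm.one_le, hJe, ae_ae_volLeaf hzero] with x h1 hJx hz
  refine le_antisymm ?_ h1
  by_contra hgt
  rw [not_le] at hgt
  have hJ1 : 1 < J x := hJx ▸ hgt
  have h0 : F.leafIntegral f₀ (F.leaf x) = 0 := by
    rw [leafIntegral, ← lintegral_zero]
    refine lintegral_congr_ae ?_
    filter_upwards [hz, ae_volLeaf_mem_leaf x] with y hy hyl
    rw [hy (hJl x y hyl ▸ hJ1), ENNReal.ofReal_zero]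
  rw [h0] at h1
  simp at h1

/-- On a set `S` of leaves that meet `A` in measure at least `1 / c`, an admissible function may be
replaced by the constant `c` on `A` and zero elsewhere. -/
theorem IsAdmissible.indicator_add_indicator_compl (hf₀ : F.IsAdmissible p f₀) {A S : Set M}
    (hA : IsCompact A) (hS : MeasurableSet S) (hSl : ∀ x, ∀ y ∈ F.leaf x, (y ∈ S ↔ x ∈ S)) {c : ℝ}
    (hc : 0 ≤ c) (hSA : ∀ x ∈ S, 1 ≤ ENNReal.ofReal c * F.volLeaf (F.leaf x) A) :
    F.IsAdmissible p fun x => (A ∩ S).indicator (fun _ => c) x + Sᶜ.indicator f₀ x where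
  memLp := by
    have hfin : F.volM (A ∩ S) ≠ ⊤ :=
      ((measure_mono inter_subset_left).trans_lt hA.measure_lt_top).ne
    exact (memLp_indicator_const _ (hA.measurableSet.inter hS) c (Or.inr hfin)).add
      (hf₀.memLp.indicator hS.compl)
  nonneg := by
    filter_upwards [hf₀.nonneg] with x hx
    exact add_nonneg (indicator_nonneg (fun _ _ => hc) _) (indicator_apply_nonneg fun _ => hx)
  one_le := by
    filter_upwards [hf₀.one_le] with x h1
    by_cases hx : x ∈ S
    · refine (hSA x hx).trans ?_
      rw [← lintegral_indicator_const hA.measurableSet]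
      refine lintegral_mono_ae ?_
      filter_upwards [ae_volLeaf_mem_leaf x] with y hy
      have hyS : y ∈ S := (hSl x y hy).2 hx
      by_cases hyA : y ∈ A <;> simp [hyS, hyA]
    · refine h1.trans_eq (lintegral_congr_ae ?_)
      filter_upwards [ae_volLeaf_mem_leaf x] with y hy
      have hyS : y ∉ S := fun hyS => hx ((hSl x y hy).1 hyS)
      simp [hyS]

/-- An extremal function that vanishes on `A` vanishes on every set of leaves that meet `A` in
measure bounded below. -/
theorem IsExtremal.ae_eq_zero_of_mem (hp : 1 < p) (hf₀ : F.IsExtremal p f₀) {A S : Set M}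
    (hA : IsCompact A) (hS : MeasurableSet S) (hSl : ∀ x, ∀ y ∈ F.leaf x, (y ∈ S ↔ x ∈ S)) {c : ℝ}
    (hc : 0 ≤ c) (hSA : ∀ x ∈ S, 1 ≤ ENNReal.ofReal c * F.volLeaf (F.leaf x) A)
    (hfA : ∀ᵐ x ∂F.volM, x ∈ A → f₀ x = 0) : ∀ᵐ x ∂F.volM, x ∈ S → f₀ x = 0 := by
  have hp0 : 0 < p := one_pos.trans hp
  have hadm := hf₀.isAdmissible
  have hfin := hadm.lintegral_rpow_ne_top hp0
  have hfinSc : ∫⁻ x in Sᶜ, ‖f₀ x‖ₑ ^ p ∂F.volM ≠ ⊤ :=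
    ne_top_of_le_ne_top hfin (setLIntegral_le_lintegral _ _)
  have hzero : ∫⁻ x in S, ‖f₀ x‖ₑ ^ p ∂F.volM = 0 := by
    refine ENNReal.eq_zero_of_forall_le_rpow_mul (b := ‖c‖ₑ ^ p * F.volM A) hp
      (ne_top_of_le_ne_top hfin (setLIntegral_le_lintegral _ _))
      (ENNReal.mul_ne_top (ENNReal.rpow_ne_top_of_nonneg hp0.le enorm_ne_top)
        hA.measure_lt_top.ne) ?_
    intro ε hε hε1
    have hε' : 0 ≤ 1 - ε := by linarith
    obtain ⟨h, hh⟩ : ∃ h : M → ℝ, h = fun x =>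
      (A ∩ S).indicator (fun _ => c) x + Sᶜ.indicator f₀ x := ⟨_, rfl⟩
    have hadm' : F.IsAdmissible p h := hh ▸ hadm.indicator_add_indicator_compl hA hS hSl hc hSA
    -- Off `S` the convex combination equals `f₀`, so those finite contributions cancel. On `S` it
    -- is `ε c` on `A`, where `f₀ = 0`, and `(1 - ε) f₀` outside `A`.
    have hle := hf₀.lintegral_rpow_le hp0 (hadm.convexComb hadm' hε.le hε1.le)
    rw [← lintegral_add_compl (fun x => ‖f₀ x‖ₑ ^ p) hS,
      ← lintegral_add_compl (fun x => ‖(1 - ε) * f₀ x + ε * h x‖ₑ ^ p) hS] at hle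
    have hcompl : ∫⁻ x in Sᶜ, ‖(1 - ε) * f₀ x + ε * h x‖ₑ ^ p ∂F.volM =
        ∫⁻ x in Sᶜ, ‖f₀ x‖ₑ ^ p ∂F.volM := by
      refine setLIntegral_congr_fun hS.compl fun x hx => ?_
      have hxS : x ∉ S := hx
      have h1 : h x = f₀ x := by simp [hh, hxS]
      have h2 : (1 - ε) * f₀ x + ε * h x = f₀ x := by rw [h1]; ring
      simp only [h2]
    rw [hcompl] at hle
    refine ((ENNReal.add_le_add_iff_right hfinSc).1 hle).trans ?_
    calc ∫⁻ x in S, ‖(1 - ε) * f₀ x + ε * h x‖ₑ ^ p ∂F.volM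
        ≤ ∫⁻ x in S, (ENNReal.ofReal (1 - ε) ^ p * ‖f₀ x‖ₑ ^ p + A.indicator
          (fun _ => ENNReal.ofReal ε ^ p * ‖c‖ₑ ^ p) x) ∂F.volM := by
          refine lintegral_mono_ae ?_
          filter_upwards [ae_restrict_mem hS, ae_restrict_of_ae hfA] with x hxS hfx
          by_cases hxA : x ∈ A
          · have h1 : h x = c := by simp [hh, hxS, hxA]
            rw [hfx hxA, h1, mul_zero, zero_add, indicator_of_mem hxA, enorm_mul,
              Real.enorm_of_nonneg hε.le, ENNReal.mul_rpow_of_nonneg _ _ hp0.le]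
            exact le_add_self
          · have h1 : h x = 0 := by simp [hh, hxS, hxA]
            rw [h1, mul_zero, add_zero, indicator_of_notMem hxA, add_zero, enorm_mul,
              Real.enorm_of_nonneg hε', ENNReal.mul_rpow_of_nonneg _ _ hp0.le]
      _ = ENNReal.ofReal (1 - ε) ^ p * ∫⁻ x in S, ‖f₀ x‖ₑ ^ p ∂F.volM +
          ENNReal.ofReal ε ^ p * ‖c‖ₑ ^ p * F.volM.restrict S A := by
          rw [lintegral_add_right _ (measurable_const.indicator hA.measurableSet),
            lintegral_indicator_const hA.measurableSet, lintegral_const_mul' _ _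
              (ENNReal.rpow_ne_top_of_nonneg hp0.le ENNReal.ofReal_ne_top)]
      _ ≤ _ := by
          rw [← mul_assoc]
          exact add_le_add_right (mul_le_mul_right (Measure.restrict_apply_le _ _) _) _
  have h1 := (lintegral_eq_zero_iff' (hadm.memLp.1.enorm.pow_const p).restrict).1 hzero
  filter_upwards [(ae_restrict_iff' hS).1 h1] with x hx hxS
  have h2 := hx hxS
  simpa [ENNReal.rpow_eq_zero_iff, hp0, hp0.not_gt] using h2

/-- The leaves that meet a compact set `A` on which an extremal function vanishes in positive
measure form a null set, and hence so does `A`. -/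
theorem IsExtremal.volM_eq_zero_of_isCompact (hp : 1 < p) (hf₀ : F.IsExtremal p f₀) {A : Set M}
    (hA : IsCompact A) (hfA : ∀ᵐ x ∂F.volM, x ∈ A → f₀ x = 0) : F.volM A = 0 := by
  have key : ∀ n : ℕ, ∀ᵐ x ∂F.volM, ¬ ((n : ℝ≥0∞) + 1)⁻¹ < F.volLeaf (F.leaf x) A := by
    intro n
    have hS : MeasurableSet {x | ((n : ℝ≥0∞) + 1)⁻¹ < F.volLeaf (F.leaf x) A} :=
      measurableSet_lt measurable_const (measurable_volLeaf_of_isSigmaCompact hA.isSigmaCompact)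
    have hSl : ∀ x, ∀ y ∈ F.leaf x,
        (y ∈ {x | ((n : ℝ≥0∞) + 1)⁻¹ < F.volLeaf (F.leaf x) A} ↔
          x ∈ {x | ((n : ℝ≥0∞) + 1)⁻¹ < F.volLeaf (F.leaf x) A}) := fun x y hy => by
      simp only [mem_ofPred_eq, F.leaf_eq_of_mem hy]
    have hvan := hf₀.ae_eq_zero_of_mem hp hA hS hSl (c := (n : ℝ) + 1) (by positivity)
      (fun x hx => by
        calc (1 : ℝ≥0∞) = ((n : ℝ≥0∞) + 1) * ((n : ℝ≥0∞) + 1)⁻¹ :=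
              (ENNReal.mul_inv_cancel (by simp) (by simp)).symm
          _ ≤ ((n : ℝ≥0∞) + 1) * F.volLeaf (F.leaf x) A := by gcongr; exact le_of_lt hx
          _ = _ := by
            rw [ENNReal.ofReal_add (by positivity) zero_le_one, ENNReal.ofReal_natCast,
              ENNReal.ofReal_one]) hfA
    -- `f₀` vanishes almost everywhere on almost every leaf of the `n`-th family, so such a leaf has
    -- integral 0, contradicting admissibility.
    filter_upwards [hf₀.isAdmissible.one_le, ae_ae_volLeaf hvan] with x h1 h2 hx
    have h0 : F.leafIntegral f₀ (F.leaf x) = 0 := by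
      rw [leafIntegral, ← lintegral_zero]
      refine lintegral_congr_ae ?_
      filter_upwards [h2, ae_volLeaf_mem_leaf x] with y hy hyl
      rw [hy ((hSl x y hyl).2 hx), ENNReal.ofReal_zero]
    rw [h0] at h1
    simp at h1
  refine volM_eq_zero_of_ae_inter_leaf hA.measurableSet ?_
  filter_upwards [ae_all_iff.2 key] with x hx
  rw [← volLeaf_eq_inter]
  by_contra hne
  obtain ⟨n, hn⟩ := ENNReal.exists_inv_nat_lt hne
  exact hx n ((ENNReal.inv_le_inv.2 le_self_add).trans_lt hn)

theorem IsExtremal.ae_pos (hp : 1 < p) (hf₀ : F.IsExtremal p f₀) : ∀ᵐ x ∂F.volM, 0 < f₀ x := by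
  have hadm := hf₀.isAdmissible
  -- A Borel representative makes the zero set Borel, hence σ-compact up to a null set.
  obtain ⟨f, hfm, hff⟩ := hadm.memLp.1.aemeasurable
  have hE : MeasurableSet {x | f x = 0} := hfm (measurableSet_singleton 0)
  have hE0 : F.volM {x | f x = 0} = 0 := by
    obtain ⟨S, hSE, ⟨K, hK, rfl⟩, hnull⟩ := F.exists_isSigmaCompact_subset_diff_volM_null hE
    have h0 : F.volM (⋃ n, K n) = 0 := measure_iUnion_null fun n =>
      hf₀.volM_eq_zero_of_isCompact hp (hK n) <| by
        filter_upwards [hff] with x hx hxK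
        exact hx.trans (hSE (mem_iUnion.2 ⟨n, hxK⟩))
    refine measure_mono_null ?_ (measure_union_null h0 hnull)
    rw [union_sdiff_self]
    exact subset_union_right
  have h1 : ∀ᵐ x ∂F.volM, f x ≠ 0 := by
    rw [ae_iff]
    simpa only [ne_eq, not_not] using hE0
  filter_upwards [h1, hadm.nonneg, hff] with x h1 h2 h3
  exact lt_of_le_of_ne h2 fun h => h1 (h3 ▸ h.symm)

end SmoothFoliation

theorem proposition3p5 {k q : ℕ} {M : Type*} [EMetricSpace M]
    [ChartedSpace (EuclideanSpace ℝ (Fin (k + q))) M] [IsManifold (𝓡 (k + q)) ∞ M]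
    [SecondCountableTopology M]
    [RiemannianBundle (fun x : M => TangentSpace (𝓡 (k + q)) x)]
    [IsContMDiffRiemannianBundle (𝓡 (k + q)) ∞ (EuclideanSpace ℝ (Fin (k + q)))
      (fun x : M => TangentSpace (𝓡 (k + q)) x)]
    [IsRiemannianManifold (𝓡 (k + q)) M]
    [MeasurableSpace M] [BorelSpace M]
    (F : SmoothFoliation k q M) (p : ℝ) (hp : 1 < p) (f₀ : M → ℝ) (hf₀ : F.IsExtremal p f₀) :
    (F.AlmostEveryLeaf fun L => F.leafIntegral f₀ L = 1) ∧ ∀ᵐ x ∂F.volM, 0 < f₀ x :=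
  ⟨hf₀.ae_leafIntegral_eq_one hp, hf₀.ae_pos hp⟩
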